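/- A bimodal formula is built from propositional variables $\mathsf P_0,\mathsf P_1,\dots$ by $\neg$, $\wedge$, $\Diamond_0$, $\Diamond_1$, interpreted by Kripke semantics in $2$-frames $\langle W,R_0,R_1\rangle$ with $W\neq\emptyset$. The product of frames $\langle W_0,R_0\rangle$ and $\langle W_1,R_1\rangle$ is the $2$-frame on $W_0\times W_1$ whose first relation relates $\langle u,v\rangle$ to $\langle u',v'\rangle$ iff $uR_0u'$ and $v=v'$, and whose second relation relates them iff $vR_1v'$ and $u=u'$. Let $\mathcal C^{fin}_{lin}$ be the class of all (irreflexive) finite linear orders $\langle T,<\rangle$, let $\mathcal C_{diff}$ be the class of all difference frames $\langle D,\neq\rangle$, and let $\mathcal C^{fin}_{diff}$ be the class of those with $D$ finite. For classes of frames $\mathcal C_0,\mathcal C_1$, the $\mathcal C_0\times\mathcal C_1$-satisfiability problem asks whether a given bimodal formula is true at some point of some model based on a product of a frame in $\mathcal C_0$ and a frame in $\mathcal C_1$. Theorem. $\mathcal C^{fin}_{lin}\times\mathcal C_{diff}$-satisfiability is recursively enumerable but undecidable. Moreover, the following problem is many-one reducible to it: given a nondeterministic counter machine $M$ (with increment,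 decrement and zero-test instructions) and states $q_0$, $q_r$, does $M$ have a run that starts in $q_0$ with all counters $0$ and reaches $q_r$? Furthermore, a bimodal formula is $\mathcal C^{fin}_{lin}\times\mathcal C_{diff}$-satisfiable if and only if it is $\mathcal C^{fin}_{lin}\times\mathcal C^{fin}_{diff}$-satisfiable. -/

import Mathlib

universe u

namespace Bimodal

/-! Bimodal formulas over the propositional variables `P 0, P 1, P 2, …` -/

/-- Bimodal formulas. -/
inductive Formula : Type
  | var : ℕ → Formula
  | neg : Formula → Formula
  | and : Formula → Formula → Formula
  | dia0 : Formula → Formula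
  | dia1 : Formula → Formula

namespace Formula

/-- The Gödel number of a formula. -/
def toNat : Formula → ℕ
  | var p => 5 * p
  | neg φ => 5 * toNat φ + 1
  | and φ ψ => 5 * Nat.pair (toNat φ) (toNat ψ) + 2
  | dia0 φ => 5 * toNat φ + 3
  | dia1 φ => 5 * toNat φ + 4

/-- The formula with a given Gödel number. -/
def ofNat (n : ℕ) : Formula :=
  if n % 5 = 0 then var (n / 5)
  else if n % 5 = 1 then neg (ofNat (n / 5))
  else if n % 5 = 2 then and (ofNat (n / 5).unpair.1) (ofNat (n / 5).unpair.2)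
  else if n % 5 = 3 then dia0 (ofNat (n / 5))
  else dia1 (ofNat (n / 5))
termination_by n
decreasing_by
  · omega
  · have := Nat.unpair_left_le (n / 5); omega
  · have := Nat.unpair_right_le (n / 5); omega
  · omega
  · omega

theorem ofNat_toNat (φ : Formula) : ofNat (toNat φ) = φ := by
  induction φ with
  | var p => rw [ofNat]; simp [toNat]
  | neg φ ih =>
    have h1 : (5 * toNat φ + 1) % 5 = 1 := by omega
    have h2 : (5 * toNat φ + 1) / 5 = toNat φ := by omega
    rw [toNat, ofNat]; simp [h1, h2, ih]
  | and φ ψ ih1 ih2 =>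
    have h1 : (5 * Nat.pair (toNat φ) (toNat ψ) + 2) % 5 = 2 := by omega
    have h2 : (5 * Nat.pair (toNat φ) (toNat ψ) + 2) / 5
        = Nat.pair (toNat φ) (toNat ψ) := by omega
    rw [toNat, ofNat]; simp [h1, h2, ih1, ih2]
  | dia0 φ ih =>
    have h1 : (5 * toNat φ + 3) % 5 = 3 := by omega
    have h2 : (5 * toNat φ + 3) / 5 = toNat φ := by omega
    rw [toNat, ofNat]; simp [h1, h2, ih]
  | dia1 φ ih =>
    have h1 : (5 * toNat φ + 4) % 5 = 4 := by omega
    have h2 : (5 * toNat φ + 4) / 5 = toNat φ := by omega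
    rw [toNat, ofNat]; simp [h1, h2, ih]

theorem toNat_ofNat (n : ℕ) : toNat (ofNat n) = n := by
  induction n using Nat.strong_induction_on with
  | _ n ih =>
    rw [ofNat]
    split_ifs with h0 h1 h2 h3
    · simp only [toNat]; omega
    · simp only [toNat]; rw [ih (n / 5) (by omega)]; omega
    · have hl := Nat.unpair_left_le (n / 5)
      have hr := Nat.unpair_right_le (n / 5)
      simp only [toNat]
      rw [ih _ (by omega), ih _ (by omega), Nat.pair_unpair]; omega
    · simp only [toNat]; rw [ih (n / 5) (by omega)]; omega
    · simp only [toNat]; rw [ih (n / 5) (by omega)]; omega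

/-- The effective Gödel numbering of formulas, as a bijection with `ℕ`. -/
def equivNat : Formula ≃ ℕ where
  toFun := toNat
  invFun := ofNat
  left_inv := ofNat_toNat
  right_inv := toNat_ofNat

instance : Primcodable Formula := Primcodable.ofEquiv ℕ equivNat

end Formula

/-! Frames, models, truth -/

/-- A (unimodal) frame. -/
structure Frame : Type (u + 1) where
  W : Type u
  nonempty : Nonempty W
  R : W → W → Prop

/-- A 2-frame. -/
structure TwoFrame : Type (u + 1) where
  W : Type u
  nonempty : Nonempty W
  R0 : W → W → Prop
  R1 : W → W → Prop

/-- Truth of a formula at a point of the model based on `F` with valuation `ν`. -/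
def Truth (F : TwoFrame.{u}) (ν : ℕ → Set F.W) : F.W → Formula → Prop
  | w, .var p => w ∈ ν p
  | w, .neg φ => ¬ Truth F ν w φ
  | w, .and φ ψ => Truth F ν w φ ∧ Truth F ν w ψ
  | w, .dia0 φ => ∃ v, F.R0 w v ∧ Truth F ν v φ
  | w, .dia1 φ => ∃ v, F.R1 w v ∧ Truth F ν v φ

/-- `φ` is satisfied in a model based on some 2-frame in the class `C`. -/
def Satisfiable (C : Set TwoFrame.{u}) (φ : Formula) : Prop :=
  ∃ F ∈ C, ∃ (ν : ℕ → Set F.W) (w : F.W), Truth F ν w φ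

/-- The product of two frames. -/
def Frame.prod (F0 F1 : Frame.{u}) : TwoFrame.{u} where
  W := F0.W × F1.W
  nonempty :=
    have := F0.nonempty
    have := F1.nonempty
    inferInstance
  R0 x y := F0.R x.1 y.1 ∧ x.2 = y.2
  R1 x y := F1.R x.2 y.2 ∧ x.1 = y.1

/-- The class of all products of a frame in `C0` and a frame in `C1`. -/
def classProd (C0 C1 : Set Frame.{u}) : Set TwoFrame.{u} :=
  {G | ∃ F0 ∈ C0, ∃ F1 ∈ C1, G = F0.prod F1}

/-- Linear orders: irreflexive, transitive and trichotomous relations. -/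
def linFrames : Set Frame.{u} :=
  {F | (∀ x, ¬ F.R x x) ∧ (∀ x y z, F.R x y → F.R y z → F.R x z) ∧
    ∀ x y, F.R x y ∨ x = y ∨ F.R y x}

/-- Finite linear orders. -/
def finLinFrames : Set Frame.{u} := {F | F ∈ linFrames ∧ Finite F.W}

/-- Difference frames. -/
def diffFrames : Set Frame.{u} := {F | ∀ x y, F.R x y ↔ x ≠ y}

/-- Finite difference frames. -/
def finDiffFrames : Set Frame.{u} := {F | F ∈ diffFrames ∧ Finite F.W}

/-! Counter machines -/

/-- Operations on the counters `c 0, c 1, …`: increment, decrement, test for zero. -/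
inductive CounterOp : Type
  | inc : ℕ → CounterOp
  | dec : ℕ → CounterOp
  | test : ℕ → CounterOp

/-- Operations as a disjoint union of three copies of the set of counter indices. -/
def CounterOp.equivSum : CounterOp ≃ ℕ ⊕ ℕ ⊕ ℕ where
  toFun
    | .inc i => .inl i
    | .dec i => .inr (.inl i)
    | .test i => .inr (.inr i)
  invFun
    | .inl i => .inc i
    | .inr (.inl i) => .dec i
    | .inr (.inr i) => .test i
  left_inv := by rintro (_ | _ | _) <;> rfl
  right_inv := by rintro (_ | _ | _) <;> rfl

instance : Primcodable CounterOp := Primcodable.ofEquiv (ℕ ⊕ ℕ ⊕ ℕ) CounterOp.equivSum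

/-- A (nondeterministic) counter machine, given by its finite list of instructions
`(q, ι, q')`, meaning `(ι, q') ∈ I_q`.  States are natural numbers; the terminal states are
those without instructions.  Only the finitely many states and counters that are mentioned in the
list matter: no other state can be entered by a step, and no other counter is ever changed or
tested, so no bound on the number of states or counters has to be part of the data. -/
abbrev CounterMachine : Type := List (ℕ × CounterOp × ℕ)

/-- A configuration: the current state and the contents of the counters. -/
abbrev Config : Type := ℕ × (ℕ → ℕ)

/-- The effect of an operation on the contents of the counters. -/
def CounterOp.Effect : CounterOp → (ℕ → ℕ) → (ℕ → ℕ) → Prop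
  | .inc i, c, c' => c' i = c i + 1 ∧ ∀ j, j ≠ i → c' j = c j
  | .dec i, c, c' => 0 < c i ∧ c' i = c i - 1 ∧ ∀ j, j ≠ i → c' j = c j
  | .test i, c, c' => c i = 0 ∧ ∀ j, c' j = c j

/-- A (reliable) step of the machine `M`. -/
def CounterMachine.Step (M : CounterMachine) (σ σ' : Config) : Prop :=
  ∃ ι : CounterOp, (σ.1, ι, σ'.1) ∈ M ∧ ι.Effect σ.2 σ'.2

/-- Counter machine reachability, with input `(M, q₀, qᵣ)`: the machine `M` has a run that starts
in state `q₀` with all counters `0` and reaches the state `qᵣ`. -/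
def CMReachability (x : CounterMachine × ℕ × ℕ) : Prop :=
  ∃ c : ℕ → ℕ, Relation.ReflTransGen (CounterMachine.Step x.1) (x.2.1, fun _ => 0) (x.2.2, c)

end Bimodal

/-! Hardness. Read `(t, d)` as a moment and a token. A counter is the set of tokens that have been
added and not yet removed, and both properties persist once acquired. The difference modality
expresses "exactly one token", so increments and decrements change a counter by exactly one, without
errors; a zero test says that the set is empty. The strict future alone does not single out the next
moment, but a token that ticks at some later moment, and never at a moment two steps away, does.
Every moment of the encoded run whose state is not the goal requires a next one, and a finite order
has no infinite ascent, so a model yields a run to the goal. Conversely, a run yields a model in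
which tokens are numbers and counters are queues. This is
`RunFormula.cmReachability_iff_satisfiable`.

Undecidability then comes from `not_computablePred_cmReachability`, a reduction from the halting
problem. Only the existence of a successful run matters, so machines may guess and check: by
induction over `Nat.Partrec'`, the graph of every partial recursive function can be checked by a
nondeterministic machine (`TestableFun.of_partrec`), and guessing the value makes reachability
equivalent to convergence.

Finite models. Over a fixed finite order and finitely many variables, a column has finitely many
possible types, and the difference modality only distinguishes types realised never, once, or at
least twice. Keeping two columns of each type (and the column of evaluation) suffices, by
bisimulation (`satisfiable_finLin_diff_iff`). Satisfiability is therefore witnessed by a finite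
truth table whose correctness is primitive recursive (`exists_certificate_iff`), which gives
recursive enumerability. -/

namespace Bimodal

/-! Machine fragments -/

/-- `M.ReachesIn r k σ`: some run of `M` from `σ` is in state `r` after exactly `k` steps. -/
def CounterMachine.ReachesIn (M : CounterMachine) (r : ℕ) : ℕ → Config → Prop
  | 0, σ => σ.1 = r
  | k + 1, σ => ∃ σ', M.Step σ σ' ∧ M.ReachesIn r k σ'

theorem CounterMachine.exists_reachesIn_iff (M : CounterMachine) (r : ℕ) (σ : Config) :
    (∃ k, M.ReachesIn r k σ) ↔ ∃ c, Relation.ReflTransGen M.Step σ (r, c) := by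
  constructor
  · rintro ⟨k, hk⟩
    induction k generalizing σ with
    | zero => exact ⟨σ.2, by cases hk; exact .refl⟩
    | succ k ih =>
      obtain ⟨σ', hs, h⟩ := hk
      obtain ⟨c, hc⟩ := ih _ h
      exact ⟨c, .head hs hc⟩
  · rintro ⟨c, hc⟩
    induction hc using Relation.ReflTransGen.head_induction_on with
    | refl => exact ⟨0, rfl⟩
    | head hs _ ih =>
      obtain ⟨k, hk⟩ := ih
      exact ⟨k + 1, _, hs, hk⟩

/-- A relation between counter contents is implementable if, for every continuation state `b`,
there is a machine fragment with states in some `[n, n')` and an entry state `a` such that, in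
every machine containing the fragment and no further instructions for its states, a goal state
outside of the fragment is reached from `a` by performing `S` and continuing from `b`. -/
def Implementable (S : (ℕ → ℕ) → (ℕ → ℕ) → Prop) : Prop :=
  ∀ n b : ℕ, ∃ (L : CounterMachine) (a n' : ℕ), n ≤ n' ∧ (∀ x ∈ L, n ≤ x.1 ∧ x.1 < n') ∧
    ∀ (M : CounterMachine) (r : ℕ), (r < n ∨ n' ≤ r) →
      (∀ x, n ≤ x.1 → x.1 < n' → (x ∈ M ↔ x ∈ L)) →
      (∀ c c', S c c' → (∃ k, M.ReachesIn r k (b, c')) → ∃ k, M.ReachesIn r k (a, c)) ∧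
      ∀ k c, M.ReachesIn r k (a, c) → ∃ c', S c c' ∧ ∃ j < k, M.ReachesIn r j (b, c')

namespace Implementable

theorem effect (ι : CounterOp) : Implementable ι.Effect := by
  intro n b
  refine ⟨[(n, ι, b)], n, n + 1, by omega, by simp, ?_⟩
  intro M r hr hM
  have hmem : ∀ ι' q, (n, ι', q) ∈ M ↔ ι' = ι ∧ q = b := by
    intro ι' q
    rw [hM _ (le_refl _) (Nat.lt_succ_self _)]
    simp
  constructor
  · rintro c c' h ⟨k, hk⟩
    exact ⟨k + 1, (b, c'), ⟨ι, (hmem _ _).2 ⟨rfl, rfl⟩, h⟩, hk⟩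
  · rintro (_ | k) c hk
    · simp only [CounterMachine.ReachesIn] at hk; omega
    · obtain ⟨⟨q, c'⟩, ⟨ι', hι, he⟩, hk⟩ := hk
      obtain ⟨rfl, rfl⟩ := (hmem _ _).1 hι
      exact ⟨c', he, k, by omega, hk⟩

/-- The fragment for `T` is built first, because its entry state is the continuation of the fragment
for `S`. -/
theorem comp {S T : (ℕ → ℕ) → (ℕ → ℕ) → Prop} (hS : Implementable S) (hT : Implementable T) :
    Implementable (Relation.Comp S T) := by
  intro n b
  obtain ⟨L₂, a₂, n₂, hn₂, hL₂, h₂⟩ := hT n b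
  obtain ⟨L₁, a₁, n₁, hn₁, hL₁, h₁⟩ := hS n₂ a₂
  refine ⟨L₁ ++ L₂, a₁, n₁, by omega, ?_, ?_⟩
  · intro x hx
    rcases List.mem_append.1 hx with hx | hx
    · have := hL₁ x hx; omega
    · have := hL₂ x hx; omega
  · intro M r hr hM
    obtain ⟨c₂, s₂⟩ := h₂ M r (by omega) fun x hx hx' => by
      rw [hM x hx (by omega), List.mem_append, or_iff_right]
      intro h; have := hL₁ x h; omega
    obtain ⟨c₁, s₁⟩ := h₁ M r (by omega) fun x hx hx' => by
      rw [hM x (by omega) hx', List.mem_append, or_iff_left]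
      intro h; have := hL₂ x h; omega
    constructor
    · rintro c c' ⟨d, hd, hd'⟩ hk
      exact c₁ _ _ hd (c₂ _ _ hd' hk)
    · intro k c hk
      obtain ⟨d, hd, j, hj, hjd⟩ := s₁ _ _ hk
      obtain ⟨c', hc', i, hi, h⟩ := s₂ _ _ hjd
      exact ⟨c', ⟨d, hd, hc'⟩, i, by omega, h⟩

/-- State `n` chooses between leaving to `b` and entering the loop body, whose continuation is `n`
again. No operation is an unconditional jump, so each choice increments and then decrements counter
`0`. Soundness is a strong induction on the length of the run; the bound `j < k` in `Implementable`
serves this purpose. -/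
theorem reflTransGen {S : (ℕ → ℕ) → (ℕ → ℕ) → Prop} (hS : Implementable S) :
    Implementable (Relation.ReflTransGen S) := by
  intro n b
  obtain ⟨L, a, n₁, hn₁, hL, h⟩ := hS (n + 3) n
  refine ⟨[(n, .inc 0, n + 1), (n + 1, .dec 0, b), (n, .inc 0, n + 2), (n + 2, .dec 0, a)] ++ L,
    n, n₁, by omega, ?_, ?_⟩
  · intro x hx
    rcases List.mem_append.1 hx with hx | hx
    · simp only [List.mem_cons, List.not_mem_nil, or_false] at hx
      rcases hx with rfl | rfl | rfl | rfl <;> dsimp only <;> omega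
    · have := hL x hx; omega
  · intro M r hr hM
    obtain ⟨c₁, s₁⟩ := h M r (by omega) fun x hx hx' => by
      rw [hM x (by omega) hx', List.mem_append, or_iff_right]
      intro h
      simp only [List.mem_cons, List.not_mem_nil, or_false] at h
      rcases h with rfl | rfl | rfl | rfl <;> dsimp only at hx <;> omega
    have hLn : ∀ x ∈ L, n + 3 ≤ x.1 := fun x hx => (hL x hx).1
    have hm₀ : ∀ ι q, (n, ι, q) ∈ M ↔ ι = .inc 0 ∧ (q = n + 1 ∨ q = n + 2) := by
      intro ι q
      rw [hM _ (le_refl _) (by dsimp only; omega)]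
      have : (n, ι, q) ∉ L := fun h => by have := hLn _ h; dsimp only at this; omega
      simp [this]; tauto
    have hm₁ : ∀ ι q, (n + 1, ι, q) ∈ M ↔ ι = .dec 0 ∧ q = b := by
      intro ι q
      rw [hM _ (by dsimp only; omega) (by dsimp only; omega)]
      have : (n + 1, ι, q) ∉ L := fun h => by have := hLn _ h; dsimp only at this; omega
      simp [this]
    have hm₂ : ∀ ι q, (n + 2, ι, q) ∈ M ↔ ι = .dec 0 ∧ q = a := by
      intro ι q
      rw [hM _ (by dsimp only; omega) (by dsimp only; omega)]
      have : (n + 2, ι, q) ∉ L := fun h => by have := hLn _ h; dsimp only at this; omega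
      simp [this]
    have incdec : ∀ c d : ℕ → ℕ, (∃ e, (CounterOp.inc 0).Effect c e ∧
        (CounterOp.dec 0).Effect e d) ↔ c = d := by
      intro c d
      constructor
      · rintro ⟨e, ⟨h1, h2⟩, _, h3, h4⟩
        funext j
        by_cases hj : j = 0
        · subst hj; omega
        · rw [h4 j hj, h2 j hj]
      · rintro rfl
        refine ⟨Function.update c 0 (c 0 + 1), ⟨by simp, fun j hj => by simp [hj]⟩, by simp, by simp,
          fun j hj => by simp [hj]⟩
    have hskip : ∀ c q, (q = b ∨ q = a) → (∃ k, M.ReachesIn r k (q, c)) →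
        ∃ k, M.ReachesIn r k (n, c) := by
      rintro c q hq ⟨k, hk⟩
      obtain ⟨e, he, he'⟩ := (incdec c c).2 rfl
      rcases hq with rfl | rfl
      · exact ⟨k + 2, (n + 1, e), ⟨_, (hm₀ _ _).2 ⟨rfl, .inl rfl⟩, he⟩, _,
          ⟨_, (hm₁ _ _).2 ⟨rfl, rfl⟩, he'⟩, hk⟩
      · exact ⟨k + 2, (n + 2, e), ⟨_, (hm₀ _ _).2 ⟨rfl, .inr rfl⟩, he⟩, _,
          ⟨_, (hm₂ _ _).2 ⟨rfl, rfl⟩, he'⟩, hk⟩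
    constructor
    · intro c c' hc hk
      induction hc using Relation.ReflTransGen.head_induction_on with
      | refl => exact hskip _ _ (.inl rfl) hk
      | head hs _ ih => exact hskip _ _ (.inr rfl) (c₁ _ _ hs ih)
    · intro k
      induction k using Nat.strong_induction_on with
      | _ k ih =>
        intro c hk
        match k, hk with
        | 0, hk => simp only [CounterMachine.ReachesIn] at hk; omega
        | 1, hk =>
          obtain ⟨⟨q, e⟩, ⟨ι, hι, _⟩, hq⟩ := hk
          simp only [CounterMachine.ReachesIn] at hq
          have := ((hm₀ _ _).1 hι).2; omega
        | k + 2, hk =>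
          obtain ⟨⟨q, e⟩, ⟨ι, hι, he⟩, ⟨q', d⟩, ⟨ι', hι', he'⟩, hk⟩ := hk
          obtain ⟨rfl, rfl | rfl⟩ := (hm₀ _ _).1 hι
          · obtain ⟨rfl, rfl⟩ := (hm₁ _ _).1 hι'
            obtain rfl := (incdec c d).1 ⟨e, he, he'⟩
            exact ⟨c, .refl, k, by omega, hk⟩
          · obtain ⟨rfl, rfl⟩ := (hm₂ _ _).1 hι'
            obtain rfl := (incdec c d).1 ⟨e, he, he'⟩
            obtain ⟨c₂, hc₂, j, hj, hjk⟩ := s₁ _ _ hk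
            obtain ⟨c₃, hc₃, i, hi, hik⟩ := ih j (by omega) _ hjk
            exact ⟨c₃, .head hc₂ hc₃, i, by omega, hik⟩

/-- Decrement arbitrarily often, then test for zero: the test discards the runs that leave the loop
too early. -/
theorem clear (i : ℕ) : Implementable fun c c' => c' = Function.update c i 0 := by
  convert ((effect (.dec i)).reflTransGen).comp (effect (.test i)) using 1
  funext c c'
  apply propext
  constructor
  · rintro rfl
    refine ⟨Function.update c i 0, ?_, by simp, fun _ => rfl⟩
    induction h : c i generalizing c with
    | zero => rw [← h, Function.update_eq_self]
    | succ k ih =>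
      refine .head (b := Function.update c i k) ⟨by omega, by simp [h], fun j hj => by simp [hj]⟩ ?_
      simpa using ih (Function.update c i k) (by simp)
  · rintro ⟨d, hd, h0, hc⟩
    obtain rfl : c' = d := funext hc
    have : ∀ j, j ≠ i → c' j = c j := by
      intro j hj
      clear h0 hc
      induction hd with
      | refl => rfl
      | tail _ hs ih => rw [hs.2.2 j hj, ih]
    funext j
    by_cases hj : j = i
    · subst hj; simp [h0]
    · simp [hj, this j hj]

/-- The guessing instruction: clear, then increment arbitrarily often. -/
theorem assign (i : ℕ) : Implementable fun c c' => ∃ z, c' = Function.update c i z := by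
  convert (clear i).comp ((effect (.inc i)).reflTransGen) using 1
  funext c c'
  apply propext
  constructor
  · rintro ⟨z, rfl⟩
    refine ⟨_, rfl, ?_⟩
    induction z with
    | zero => exact .refl
    | succ z ih => exact .tail ih ⟨by simp, fun j hj => by simp [hj]⟩
  · rintro ⟨d, rfl, hd⟩
    induction hd with
    | refl => exact ⟨0, rfl⟩
    | tail _ hs ih =>
      obtain ⟨z, rfl⟩ := ih
      refine ⟨z + 1, funext fun j => ?_⟩
      by_cases hj : j = i
      · subst hj; simpa using hs.1
      · rw [hs.2 j hj]; simp [hj]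

end Implementable

/-! ### Properties of counters that machines can check. -/

/-- Agreement of counter contents below `N`. -/
def AgreeBelow (N : ℕ) (c c' : ℕ → ℕ) : Prop := ∀ j < N, c j = c' j

theorem AgreeBelow.symm {N : ℕ} {c c' : ℕ → ℕ} (h : AgreeBelow N c c') : AgreeBelow N c' c :=
  fun j hj => (h j hj).symm

theorem AgreeBelow.trans {N : ℕ} {c c' d : ℕ → ℕ} (h : AgreeBelow N c c')
    (h' : AgreeBelow N c' d) : AgreeBelow N c d :=
  fun j hj => (h j hj).trans (h' j hj)

theorem AgreeBelow.mono {N N' : ℕ} {c c' : ℕ → ℕ} (h : AgreeBelow N' c c') (hN : N ≤ N') :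
    AgreeBelow N c c' :=
  fun j hj => h j (by omega)

theorem agreeBelow_update (N : ℕ) (c : ℕ → ℕ) {i : ℕ} (hi : N ≤ i) (z : ℕ) :
    AgreeBelow N c (Function.update c i z) :=
  fun j hj => by rw [Function.update_of_ne (by omega)]

/-- A property of the counters below `N` is testable if some implementable relation, which keeps
these counters, is defined precisely where the property holds. -/
structure Testable (N : ℕ) (A : (ℕ → ℕ) → Prop) : Prop where
  congr : ∀ c c', AgreeBelow N c c' → A c → A c'
  exists_rel : ∃ S, Implementable S ∧ (∀ c c', S c c' → A c ∧ AgreeBelow N c c') ∧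
    ∀ c, A c → ∃ c', S c c'

namespace Testable

theorem of_iff {N : ℕ} {A B : (ℕ → ℕ) → Prop} (hA : Testable N A) (h : ∀ c, A c ↔ B c) :
    Testable N B := by
  rwa [← show A = B from funext fun c => propext (h c)]

/-- Clearing the scratch counter `N` does nothing to the counters below it. -/
theorem true (N : ℕ) : Testable N fun _ => True :=
  ⟨fun _ _ _ _ => trivial, _, .clear N,
    fun c _ h => ⟨trivial, h ▸ agreeBelow_update N c le_rfl 0⟩, fun _ _ => ⟨_, rfl⟩⟩

theorem and {N : ℕ} {A B : (ℕ → ℕ) → Prop} (hA : Testable N A) (hB : Testable N B) :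
    Testable N fun c => A c ∧ B c := by
  obtain ⟨cA, S, iS, sS, tS⟩ := hA
  obtain ⟨cB, T, iT, sT, tT⟩ := hB
  refine ⟨fun c c' h hc => ⟨cA c c' h hc.1, cB c c' h hc.2⟩, _, iS.comp iT, ?_, ?_⟩
  · rintro c c' ⟨d, hd, hd'⟩
    obtain ⟨a1, a2⟩ := sS _ _ hd
    obtain ⟨b1, b2⟩ := sT _ _ hd'
    exact ⟨⟨a1, cB _ _ a2.symm b1⟩, a2.trans b2⟩
  · rintro c ⟨ha, hb⟩
    obtain ⟨d, hd⟩ := tS c ha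
    obtain ⟨e, he⟩ := tT d (cB _ _ (sS _ _ hd).2 hb)
    exact ⟨e, d, hd, he⟩

theorem forall_fin {N n : ℕ} {A : Fin n → (ℕ → ℕ) → Prop} (h : ∀ i, Testable N (A i)) :
    Testable N fun c => ∀ i, A i c := by
  induction n with
  | zero => exact (Testable.true N).of_iff fun c => by simp
  | succ n ih => exact ((h 0).and (ih fun i => h i.succ)).of_iff fun c => by rw [Fin.forall_fin_succ]

/-- An existential quantifier over the content of counter `N` is a guess followed by the test of
`A`. -/
theorem exists_agree_succ {N : ℕ} {A : (ℕ → ℕ) → Prop} (hA : Testable (N + 1) A) :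
    Testable N fun c => ∃ c', AgreeBelow N c c' ∧ A c' := by
  obtain ⟨cA, S, iS, sS, tS⟩ := hA
  refine ⟨fun c c' h ⟨d, hd, ha⟩ => ⟨d, h.symm.trans hd, ha⟩, _, (Implementable.assign N).comp iS,
    ?_, ?_⟩
  · rintro c c' ⟨_, ⟨z, rfl⟩, hd⟩
    obtain ⟨h1, h2⟩ := sS _ _ hd
    have h3 := agreeBelow_update N c le_rfl z
    exact ⟨⟨_, h3, h1⟩, h3.trans (h2.mono (by omega))⟩
  · rintro c ⟨d, hd, ha⟩
    obtain ⟨e, he⟩ := tS (Function.update c N (d N)) (cA d _ (fun j hj => by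
      by_cases h : j = N
      · subst h; simp
      · rw [Function.update_of_ne h, hd j (by omega)]) ha)
    exact ⟨e, _, ⟨_, rfl⟩, he⟩

theorem exists_agree {N : ℕ} (m : ℕ) {A : (ℕ → ℕ) → Prop} (hA : Testable (N + m) A) :
    Testable N fun c => ∃ c', AgreeBelow N c c' ∧ A c' := by
  induction m generalizing A with
  | zero => exact hA.of_iff fun c => ⟨fun h => ⟨c, fun _ _ => rfl, h⟩,
      fun ⟨c', h, h'⟩ => hA.congr _ _ h.symm h'⟩
  | succ m ih =>
    refine (ih (exists_agree_succ (N := N + m) hA)).of_iff fun c => ⟨?_, ?_⟩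
    · rintro ⟨d, hd, e, he, h⟩
      exact ⟨e, hd.trans (he.mono (by omega)), h⟩
    · rintro ⟨d, hd, h⟩
      exact ⟨d, hd, d, fun _ _ => rfl, h⟩

theorem eq_zero {N x : ℕ} (hx : x < N) : Testable N fun c => c x = 0 := by
  refine ⟨fun c c' h hc => (h x hx).symm.trans hc, _, .effect (.test x), ?_, ?_⟩
  · rintro c c' ⟨h, h'⟩
    exact ⟨h, fun j _ => (h' j).symm⟩
  · intro c hc
    exact ⟨c, hc, fun _ => rfl⟩

/-- Loop `S` moves `x` and `y` simultaneously into the scratch counter `N`; both must then be zero.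
Loop `T` restores them and must empty `N`. Both loops keep the sums `x + N` and `y + N`, which is
the invariant `I`. -/
theorem eq {N x y : ℕ} (hx : x < N) (hy : y < N) : Testable N fun c => c x = c y := by
  -- For a single counter the loop would decrement it twice per round, so this case is separate.
  by_cases hxy : x = y
  · subst hxy; exact (Testable.true N).of_iff fun c => by simp
  let S : (ℕ → ℕ) → (ℕ → ℕ) → Prop := Relation.Comp (CounterOp.dec x).Effect
    (Relation.Comp (CounterOp.dec y).Effect (CounterOp.inc N).Effect)
  let T : (ℕ → ℕ) → (ℕ → ℕ) → Prop := Relation.Comp (CounterOp.dec N).Effect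
    (Relation.Comp (CounterOp.inc x).Effect (CounterOp.inc y).Effect)
  let I : (ℕ → ℕ) → (ℕ → ℕ) → Prop := fun c c' => c x + c N = c' x + c' N ∧
    c y + c N = c' y + c' N ∧ ∀ j < N, j ≠ x → j ≠ y → c j = c' j
  have hS : ∀ c c', Relation.ReflTransGen S c c' → I c c' := by
    intro c c' h
    induction h with
    | refl => exact ⟨rfl, rfl, fun _ _ _ _ => rfl⟩
    | @tail d e _ hs ih =>
      obtain ⟨c₁, ⟨p, hx1, hx2⟩, c₂, ⟨p', hy1, hy2⟩, hN1, hN2⟩ := hs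
      obtain ⟨i1, i2, i3⟩ := ih
      have e1 := hx2 y (Ne.symm hxy); have e2 := hx2 N (by omega)
      have e3 := hy2 x hxy; have e4 := hy2 N (by omega)
      have e5 := hN2 x (by omega); have e6 := hN2 y (by omega)
      refine ⟨by omega, by omega, fun j hj h1 h2 => ?_⟩
      rw [i3 j hj h1 h2, hN2 j (by omega), hy2 j h2, hx2 j h1]
  have hT : ∀ c c', Relation.ReflTransGen T c c' → I c c' := by
    intro c c' h
    induction h with
    | refl => exact ⟨rfl, rfl, fun _ _ _ _ => rfl⟩
    | @tail d e _ hs ih =>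
      obtain ⟨c₁, ⟨p, hx1, hx2⟩, c₂, ⟨hy1, hy2⟩, hN1, hN2⟩ := hs
      obtain ⟨i1, i2, i3⟩ := ih
      have e1 := hx2 y (by omega); have e2 := hx2 x (by omega)
      have e3 := hy2 y (Ne.symm hxy); have e4 := hy2 N (by omega)
      have e5 := hN2 x hxy; have e6 := hN2 N (by omega)
      refine ⟨by omega, by omega, fun j hj h1 h2 => ?_⟩
      rw [i3 j hj h1 h2, hN2 j h2, hy2 j h1, hx2 j (by omega)]
  have tS : ∀ k c, c x = k → c y = k → ∃ c', Relation.ReflTransGen S c c' ∧ c' x = 0 ∧ c' y = 0 := by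
    intro k
    induction k with
    | zero => exact fun c h h' => ⟨c, .refl, h, h'⟩
    | succ k ih =>
      intro c h h'
      let c₁ := Function.update c x (c x - 1)
      let c₂ := Function.update c₁ y (c₁ y - 1)
      let c₃ := Function.update c₂ N (c₂ N + 1)
      have y1 : c₁ y = k + 1 := by simp [c₁, Ne.symm hxy, h']
      have x1 : c₁ x = k := by simp [c₁, h]
      obtain ⟨d, hd, h0⟩ := ih c₃
        (by rw [show c₃ x = c₂ x from Function.update_of_ne (by omega) _ _,
              show c₂ x = c₁ x from Function.update_of_ne hxy _ _, x1])
        (by rw [show c₃ y = c₂ y from Function.update_of_ne (by omega) _ _]; simp [c₂, y1])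
      refine ⟨d, .head ⟨c₁, ⟨by omega, by simp [c₁], fun j hj => by simp [c₁, hj]⟩, c₂,
        ⟨by omega, by simp [c₂], fun j hj => by simp [c₂, hj]⟩, by simp [c₃],
        fun j hj => by simp [c₃, hj]⟩ hd, h0⟩
  have tT : ∀ k c, c N = k → ∃ c', Relation.ReflTransGen T c c' ∧ c' N = 0 := by
    intro k
    induction k with
    | zero => exact fun c h => ⟨c, .refl, h⟩
    | succ k ih =>
      intro c h
      let c₁ := Function.update c N (c N - 1)
      let c₂ := Function.update c₁ x (c₁ x + 1)
      let c₃ := Function.update c₂ y (c₂ y + 1)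
      obtain ⟨d, hd, h0⟩ := ih c₃
        (by rw [show c₃ N = c₂ N from Function.update_of_ne (by omega) _ _,
              show c₂ N = c₁ N from Function.update_of_ne (by omega) _ _]; simp [c₁, h])
      refine ⟨d, .head ⟨c₁, ⟨by omega, by simp [c₁], fun j hj => by simp [c₁, hj]⟩, c₂,
        ⟨by simp [c₂], fun j hj => by simp [c₂, hj]⟩, by simp [c₃],
        fun j hj => by simp [c₃, hj]⟩ hd, h0⟩
  have iS : Implementable S := (Implementable.effect _).comp ((Implementable.effect _).comp (.effect _))
  have iT : Implementable T := (Implementable.effect _).comp ((Implementable.effect _).comp (.effect _))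
  refine ⟨fun c c' h hc => by rw [← h x hx, ← h y hy, hc], _, (Implementable.clear N).comp
    (iS.reflTransGen.comp ((Implementable.effect (.test x)).comp ((Implementable.effect (.test y)).comp
      (iT.reflTransGen.comp (.effect (.test N)))))), ?_, ?_⟩
  · rintro c c' ⟨_, rfl, c₁, h1, c₂, ⟨x0, h2⟩, c₃, ⟨y0, h3⟩, c₄, h4, N0, h5⟩
    obtain rfl : c₂ = c₁ := funext h2
    obtain rfl : c₃ = c₂ := funext h3
    obtain rfl : c' = c₄ := funext h5
    obtain ⟨a1, a2, a3⟩ := hS _ _ h1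
    obtain ⟨b1, b2, b3⟩ := hT _ _ h4
    rw [Function.update_self, Function.update_of_ne (by omega)] at a1 a2
    refine ⟨by omega, fun j hj => ?_⟩
    by_cases hjx : j = x
    · subst hjx; omega
    by_cases hjy : j = y
    · subst hjy; omega
    rw [← b3 j hj hjx hjy, ← a3 j hj hjx hjy, Function.update_of_ne (by omega)]
  · intro c hc
    obtain ⟨c₁, h1, x0, y0⟩ := tS (c x) (Function.update c N 0)
      (Function.update_of_ne (by omega) _ _)
      ((Function.update_of_ne (by omega) _ _).trans hc.symm)
    obtain ⟨c₂, h2, N0⟩ := tT _ c₁ rfl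
    exact ⟨c₂, _, rfl, c₁, h1, c₁, ⟨x0, fun _ => rfl⟩, c₁, ⟨y0, fun _ => rfl⟩, c₂, h2, N0,
      fun _ => rfl⟩

/-- Guess a copy of `x` in counter `N`, check it, increment it and compare it with `y`. -/
theorem eq_succ {N x y : ℕ} (hx : x < N) (hy : y < N) : Testable N fun c => c y = c x + 1 := by
  obtain ⟨-, S, iS, sS, tS⟩ := Testable.eq (N := N + 1) (x := N) (y := x) (by omega) (by omega)
  obtain ⟨-, T, iT, sT, tT⟩ := Testable.eq (N := N + 1) (x := N) (y := y) (by omega) (by omega)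
  refine ⟨fun c c' h hc => by rw [← h x hx, ← h y hy, hc], _, (Implementable.assign N).comp
    (iS.comp ((Implementable.effect (.inc N)).comp iT)), ?_, ?_⟩
  · rintro c c' ⟨_, ⟨z, rfl⟩, d, h1, e, ⟨hN, h2⟩, h3⟩
    obtain ⟨a1, a2⟩ := sS _ _ h1
    obtain ⟨b1, b2⟩ := sT _ _ h3
    have hag : AgreeBelow N d e := fun j hj => (h2 j (by omega)).symm
    have hcd : AgreeBelow N c d := (agreeBelow_update N c le_rfl z).trans (a2.mono (by omega))
    refine ⟨?_, hcd.trans (hag.trans (b2.mono (by omega)))⟩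
    rw [hcd y hy, hag y hy, ← b1, hN, ← a2 N (by omega), a1, Function.update_of_ne (by omega)]
  · intro c hc
    obtain ⟨d, hd⟩ := tS (Function.update c N (c x)) (by
      rw [Function.update_self, Function.update_of_ne (by omega)])
    have a2 := (sS _ _ hd).2
    obtain ⟨e, he⟩ := tT (Function.update d N (d N + 1)) (by
      rw [Function.update_self, Function.update_of_ne (by omega), ← a2 y (by omega),
        ← a2 N (by omega), Function.update_self, Function.update_of_ne (by omega), hc])
    exact ⟨e, _, ⟨_, rfl⟩, d, hd, _, ⟨Function.update_self .., fun j hj => by simp [hj]⟩, he⟩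

/-- Reflexive transitive closures of testable relations between pairs of numbers. -/
theorem reflTransGen {N : ℕ} {R : (ℕ → ℕ) → ℕ × ℕ → ℕ × ℕ → Prop}
    (hR : Testable (N + 4) fun c => R c (c N, c (N + 1)) (c (N + 2), c (N + 3)))
    (hcongr : ∀ c c', AgreeBelow N c c' → R c = R c') {a a' b b' : ℕ}
    (ha : a < N) (ha' : a' < N) (hb : b < N) (hb' : b' < N) :
    Testable N fun c => Relation.ReflTransGen (R c) (c a, c a') (c b, c b') := by
  obtain ⟨-, S, iS, sS, tS⟩ := hR
  obtain ⟨cE, E, iE, sE, tE⟩ := (Testable.eq (N := N + 4) (x := N) (y := N + 2) (by omega)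
    (by omega)).and (Testable.eq (N := N + 4) (x := N + 1) (y := N + 3) (by omega) (by omega))
  obtain ⟨-, A, iA, sA, tA⟩ := (Testable.eq (N := N + 2) (x := N) (y := a) (by omega)
    (by omega)).and (Testable.eq (N := N + 2) (x := N + 1) (y := a') (by omega) (by omega))
  obtain ⟨-, B, iB, sB, tB⟩ := (Testable.eq (N := N + 2) (x := N) (y := b) (by omega)
    (by omega)).and (Testable.eq (N := N + 2) (x := N + 1) (y := b') (by omega) (by omega))
  let G : ℕ → (ℕ → ℕ) → (ℕ → ℕ) → Prop := fun i c c' => ∃ z, c' = Function.update c i z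
  have iG : ∀ i, Implementable (G i) := Implementable.assign
  have hG : ∀ {i c c'}, N ≤ i → G i c c' → AgreeBelow N c c' := by
    rintro i c _ hi ⟨z, rfl⟩
    exact agreeBelow_update N c hi z
  -- One round: the current pair is in `N`, `N + 1`. Guess the next pair in `N + 2`, `N + 3`, test
  -- `R`, then copy it back by guessing `N`, `N + 1` anew and comparing (`E`). Before the loop `A`
  -- checks the guessed start pair, and after it `B` checks the end pair.
  let L := Relation.Comp (G (N + 2)) (Relation.Comp (G (N + 3)) (Relation.Comp S
    (Relation.Comp (G N) (Relation.Comp (G (N + 1)) E))))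
  have iL : Implementable L :=
    (iG _).comp ((iG _).comp (iS.comp ((iG _).comp ((iG _).comp iE))))
  have sL : ∀ c c', L c c' → AgreeBelow N c c' ∧
      R c (c N, c (N + 1)) (c' N, c' (N + 1)) := by
    rintro c c' ⟨_, ⟨z, rfl⟩, _, ⟨z', rfl⟩, d, h1, _, ⟨w, rfl⟩, _, ⟨w', rfl⟩, h2⟩
    obtain ⟨a1, a2⟩ := sS _ _ h1
    obtain ⟨⟨b1, b2⟩, b3⟩ := sE _ _ h2
    have h0 := (agreeBelow_update N c (i := N + 2) (by omega) z).trans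
      (agreeBelow_update N _ (i := N + 3) (by omega) z')
    have h3 := (agreeBelow_update N d le_rfl w).trans
      (agreeBelow_update N _ (i := N + 1) (by omega) w')
    refine ⟨h0.trans ((a2.mono (by omega)).trans (h3.trans (b3.mono (by omega)))), ?_⟩
    rw [hcongr _ _ h0, ← b3 N (by omega), ← b3 (N + 1) (by omega), b1, b2]
    have e2 := a2 (N + 2) (by omega)
    have e3 := a2 (N + 3) (by omega)
    simp at e2 e3 a1 ⊢
    rw [← e2, ← e3]
    exact a1
  have tL : ∀ c s, R c (c N, c (N + 1)) s → ∃ c', L c c' ∧ (c' N, c' (N + 1)) = s := by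
    rintro c ⟨s, s'⟩ h
    let c₁ := Function.update c (N + 2) s
    let c₂ := Function.update c₁ (N + 3) s'
    have h0 : AgreeBelow N c c₂ := (agreeBelow_update N c (i := N + 2) (by omega) s).trans
      (agreeBelow_update N _ (i := N + 3) (by omega) s')
    obtain ⟨d, hd⟩ := tS c₂ (by rw [← hcongr _ _ h0]; simpa [c₂, c₁] using h)
    obtain ⟨a1, a2⟩ := sS _ _ hd
    have e2 := a2 (N + 2) (by omega)
    have e3 := a2 (N + 3) (by omega)
    simp [c₂, c₁] at e2 e3
    obtain ⟨e, he⟩ := tE (Function.update (Function.update d N s) (N + 1) s') (by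
      simp [← e2, ← e3])
    obtain ⟨⟨-, -⟩, b3⟩ := sE _ _ he
    refine ⟨e, ⟨c₁, ⟨_, rfl⟩, c₂, ⟨_, rfl⟩, d, hd, _, ⟨_, rfl⟩, _, ⟨_, rfl⟩, he⟩, ?_⟩
    rw [← b3 N (by omega), ← b3 (N + 1) (by omega)]
    simp
  have sL' : ∀ c c', Relation.ReflTransGen L c c' → AgreeBelow N c c' ∧
      Relation.ReflTransGen (R c) (c N, c (N + 1)) (c' N, c' (N + 1)) := by
    intro c c' h
    induction h with
    | refl => exact ⟨fun _ _ => rfl, .refl⟩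
    | tail _ hs ih =>
      obtain ⟨h1, h2⟩ := sL _ _ hs
      exact ⟨ih.1.trans h1, .tail ih.2 (hcongr _ _ ih.1 ▸ h2)⟩
  have tL' : ∀ c s, Relation.ReflTransGen (R c) (c N, c (N + 1)) s →
      ∃ c', Relation.ReflTransGen L c c' ∧ (c' N, c' (N + 1)) = s := by
    intro c s h
    induction h with
    | refl => exact ⟨c, .refl, rfl⟩
    | tail _ hs ih =>
      obtain ⟨d, hd, rfl⟩ := ih
      rw [hcongr _ _ (sL' _ _ hd).1] at hs
      obtain ⟨e, he, rfl⟩ := tL _ _ hs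
      exact ⟨e, .tail hd he, rfl⟩
  refine ⟨?_, _, (iG N).comp ((iG (N + 1)).comp (iA.comp (iL.reflTransGen.comp iB))), ?_, ?_⟩
  · intro c c' h hc
    rwa [← h a ha, ← h a' ha', ← h b hb, ← h b' hb', ← hcongr _ _ h]
  · rintro c c' ⟨c₁, h1, c₂, h2, c₃, h3, c₄, h4, h5⟩
    have g1 := (hG le_rfl h1).trans (hG (by omega) h2)
    obtain ⟨⟨a1, a2⟩, a3⟩ := sA _ _ h3
    obtain ⟨b1, b2⟩ := sL' _ _ h4
    obtain ⟨⟨d1, d2⟩, d3⟩ := sB _ _ h5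
    have g2 : AgreeBelow N c c₃ := g1.trans (a3.mono (by omega))
    refine ⟨?_, g2.trans (b1.trans (d3.mono (by omega)))⟩
    rw [hcongr _ _ g2]
    rwa [← a3 N (by omega), ← a3 (N + 1) (by omega), a1, a2, d1, d2, ← g1 a ha, ← g1 a' ha',
      ← (g2.trans b1) b hb, ← (g2.trans b1) b' hb'] at b2
  · intro c hc
    let c₁ := Function.update c N (c a)
    let c₂ := Function.update c₁ (N + 1) (c a')
    have g1 : AgreeBelow N c c₂ := (agreeBelow_update N c le_rfl (c a)).trans
      (agreeBelow_update N _ (i := N + 1) (by omega) (c a'))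
    obtain ⟨c₃, h3⟩ := tA c₂ (by rw [← g1 a ha, ← g1 a' ha']; simp [c₂, c₁])
    obtain ⟨⟨a1, a2⟩, a3⟩ := sA _ _ h3
    have g2 : AgreeBelow N c c₃ := g1.trans (a3.mono (by omega))
    obtain ⟨c₄, h4, e4⟩ := tL' c₃ (c b, c b') (by
      rw [← a3 N (by omega), ← a3 (N + 1) (by omega), a1, a2, ← g1 a ha, ← g1 a' ha',
        ← hcongr _ _ g2]; exact hc)
    obtain ⟨e4, e4'⟩ := Prod.mk.inj e4
    obtain ⟨b1, b2⟩ := sL' _ _ h4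
    obtain ⟨c₅, h5⟩ := tB c₄ (by
      rw [← (g2.trans b1) b hb, ← (g2.trans b1) b' hb']; exact ⟨e4, e4'⟩)
    exact ⟨c₅, c₁, ⟨_, rfl⟩, c₂, ⟨_, rfl⟩, c₃, h3, c₄, h4, h5⟩

end Testable

/-! ### Graphs of partial recursive functions. -/

/-- The graph of `f` is testable for every choice of counters that hold the arguments and the
value. -/
def TestableFun {n : ℕ} (f : List.Vector ℕ n →. ℕ) : Prop :=
  ∀ (N : ℕ) (ρ : List.Vector ℕ n) (y : ℕ), (∀ i, ρ.get i < N) → y < N →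
    Testable N fun c => c y ∈ f (ρ.map c)

namespace TestableFun

theorem map_congr {n N : ℕ} {c c' : ℕ → ℕ} (h : AgreeBelow N c c') {ρ : List.Vector ℕ n}
    (hρ : ∀ i, ρ.get i < N) : ρ.map c = ρ.map c' := by
  ext i
  simp only [List.Vector.get_map]
  exact h _ (hρ i)

theorem get_cons_lt {n N x : ℕ} {ρ : List.Vector ℕ n} (hx : x < N) (hρ : ∀ i, ρ.get i < N)
    (i : Fin (n + 1)) : (x ::ᵥ ρ).get i < N := by
  refine Fin.cases ?_ (fun i => ?_) i
  · simpa using hx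
  · simpa using hρ i

theorem mem_mOfFn {n : ℕ} (p : Fin n → Part ℕ) (w : List.Vector ℕ n) :
    w ∈ List.Vector.mOfFn p ↔ ∀ i, w.get i ∈ p i := by
  induction n with
  | zero =>
    simp only [List.Vector.mOfFn, IsEmpty.forall_iff, iff_true]
    exact (Part.mem_some_iff).2 (Subsingleton.elim _ _)
  | succ n ih =>
    rw [← w.cons_head_tail]
    simp only [List.Vector.mOfFn, Part.bind_eq_bind, Part.pure_eq_some, Part.mem_bind_iff,
      Part.mem_some_iff, Fin.forall_fin_succ, List.Vector.get_zero, List.Vector.get_cons_succ,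
      List.Vector.head_cons]
    constructor
    · rintro ⟨a, ha, u, hu, he⟩
      obtain rfl : w.head = a := by simpa using congrArg List.Vector.head he
      obtain rfl : w.tail = u := by simpa using congrArg List.Vector.tail he
      exact ⟨ha, (ih _ _).1 hu⟩
    · rintro ⟨h, h'⟩
      exact ⟨_, h, _, (ih _ _).2 h', rfl⟩

/-- The values of the inner functions are guessed in the fresh counters `N, …, N + n - 1`. -/
theorem comp {m n : ℕ} {f : List.Vector ℕ n →. ℕ} {g : Fin n → List.Vector ℕ m →. ℕ}
    (hf : TestableFun f) (hg : ∀ i, TestableFun (g i)) :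
    TestableFun fun v => (List.Vector.mOfFn fun i => g i v) >>= f := by
  intro N ρ y hρ hy
  let σ : List.Vector ℕ n := List.Vector.ofFn fun i => N + i
  have hσ : ∀ i, σ.get i = N + i := fun i => by simp [σ]
  have h1 := hf (N + n) σ y (fun i => by rw [hσ]; omega) (by omega)
  have h2 : ∀ i, Testable (N + n) fun c => c (σ.get i) ∈ g i (ρ.map c) := fun i =>
    hg i (N + n) ρ _ (fun j => by have := hρ j; omega) (by rw [hσ]; omega)
  refine ((Testable.forall_fin h2).and h1).exists_agree n |>.of_iff fun c => ?_
  refine Iff.trans ?_ (Part.mem_bind_iff.trans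
    (exists_congr fun w => and_congr_left fun _ => mem_mOfFn _ w)).symm
  constructor
  · rintro ⟨d, hd, h, h'⟩
    refine ⟨σ.map d, fun i => ?_, ?_⟩
    · rw [List.Vector.get_map, map_congr hd hρ]; exact h i
    · rw [hd y hy]; exact h'
  · rintro ⟨w, hw, h'⟩
    let d : ℕ → ℕ := fun j => if h : j - N < n then if N ≤ j then w.get ⟨j - N, h⟩ else c j else c j
    have hd : AgreeBelow N c d := fun j hj => by
      simp only [d]; split_ifs <;> omega
    have hσd : ∀ i, d (σ.get i) = w.get i := fun i => by
      rw [hσ]; simp [d]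
    refine ⟨d, hd, fun i => ?_, ?_⟩
    · rw [hσd, ← map_congr hd hρ]; exact hw i
    · rw [← hd y hy, show σ.map d = w from List.Vector.ext fun i => by simp [hσd]]
      exact h'

/-- Recursion is reachability between pairs (argument, value): from `(0, f)`, each step raises the
argument and applies `g`, so exactly the graph is reached. -/
theorem prec {n : ℕ} {f : List.Vector ℕ n → ℕ} {g : List.Vector ℕ (n + 2) → ℕ}
    (hf : TestableFun fun v => Part.some (f v)) (hg : TestableFun fun v => Part.some (g v)) :
    TestableFun fun v : List.Vector ℕ (n + 1) => Part.some
      (v.head.rec (f v.tail) fun y IH => g (y ::ᵥ IH ::ᵥ v.tail)) := by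
  intro N ρ y hρ hy
  let R : (ℕ → ℕ) → ℕ × ℕ → ℕ × ℕ → Prop := fun c s s' =>
    s'.1 = s.1 + 1 ∧ s'.2 = g (s.1 ::ᵥ s.2 ::ᵥ ρ.tail.map c)
  have hρt : ∀ i, ρ.tail.get i < N := fun i => by simpa using hρ i.succ
  have hρ0 : ρ.head < N := by simpa using hρ 0
  have hR : Testable (N + 2 + 4) fun c =>
      R c (c (N + 2), c (N + 2 + 1)) (c (N + 2 + 2), c (N + 2 + 3)) := by
    refine (Testable.eq_succ (x := N + 2) (y := N + 2 + 2) (by omega) (by omega)).and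
      ((hg (N + 2 + 4) ((N + 2) ::ᵥ (N + 2 + 1) ::ᵥ ρ.tail) (N + 2 + 3) ?_ (by omega)).of_iff
        fun c => ?_)
    · exact get_cons_lt (by omega) (get_cons_lt (by omega) fun i => by have := hρt i; omega)
    · simp [List.Vector.map_cons]
  have hcongr : ∀ c c', AgreeBelow (N + 2) c c' → R c = R c' := fun c c' h => by
    simp only [R, map_congr (h.mono (by omega)) hρt]
  have h := (((Testable.eq_zero (N := N + 2) (x := N) (by omega)).and
    (hf (N + 2) ρ.tail (N + 1) (fun i => by have := hρt i; omega) (by omega))).and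
    (Testable.reflTransGen hR hcongr (a := N) (a' := N + 1) (b := ρ.head) (b' := y)
      (by omega) (by omega) (by omega) (by omega))).exists_agree
  refine h.of_iff fun c => ?_
  have key : ∀ (c : ℕ → ℕ) (s : ℕ × ℕ),
      Relation.ReflTransGen (R c) (0, f (ρ.tail.map c)) s ↔
      s.2 = s.1.rec (f (ρ.tail.map c)) fun y IH => g (y ::ᵥ IH ::ᵥ ρ.tail.map c) := by
    intro c s
    constructor
    · intro h
      induction h with
      | refl => rfl
      | @tail p q _ hs ih =>
        obtain ⟨h1, h2⟩ := hs
        rw [h1, h2, ih]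
    · obtain ⟨k, s⟩ := s
      simp only
      rintro rfl
      induction k with
      | zero => exact .refl
      | succ k ih => exact .tail ih ⟨rfl, rfl⟩
  have hhead : (ρ.map c).head = c ρ.head := by rw [← List.Vector.get_zero, List.Vector.get_map]; simp
  have htail : (ρ.map c).tail = ρ.tail.map c := by
    ext i; simp
  simp only [Part.mem_some_iff, hhead, htail]
  constructor
  · rintro ⟨d, hd, ⟨h0, h1⟩, h2⟩
    rw [h0, h1, key] at h2
    rw [map_congr hd hρt, hd _ hy, hd _ hρ0]
    exact h2
  · intro h
    let d := Function.update (Function.update c N 0) (N + 1) (f (ρ.tail.map c))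
    have hd : AgreeBelow N c d := (agreeBelow_update N c le_rfl 0).trans
      (agreeBelow_update N _ (i := N + 1) (by omega) _)
    have d0 : d N = 0 := by simp [d]
    have d1 : d (N + 1) = f (ρ.tail.map d) := by rw [← map_congr hd hρt]; simp [d]
    refine ⟨d, hd, ⟨d0, d1⟩, ?_⟩
    rw [d0, d1, key]
    rw [map_congr hd hρt, hd _ hy, hd _ hρ0] at h
    exact h

/-- A step from `k` to `k + 1` is allowed only where `f` does not vanish, so `k` is reached from `0`
iff there is no smaller zero. The second components are a constant dummy `0`, since
`Testable.reflTransGen` is about pairs. -/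
theorem rfind {n : ℕ} {f : List.Vector ℕ (n + 1) → ℕ} (hf : TestableFun fun v => Part.some (f v)) :
    TestableFun fun v => Nat.rfind fun k => Part.some (decide (f (k ::ᵥ v) = 0)) := by
  intro N ρ y hρ hy
  let R : (ℕ → ℕ) → ℕ × ℕ → ℕ × ℕ → Prop := fun c s s' =>
    s'.1 = s.1 + 1 ∧ s'.2 = 0 ∧ f (s.1 ::ᵥ ρ.map c) ≠ 0
  -- Being nonzero is tested as being a successor: the predecessor and the value are guessed in two
  -- further counters.
  have hne : Testable (N + 1 + 4) fun c => f (c (N + 1) ::ᵥ ρ.map c) ≠ 0 := by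
    have hlt : ∀ i, ((N + 1) ::ᵥ ρ).get i < N + 1 + 4 + 2 :=
      get_cons_lt (by omega) fun i => by have := hρ i; omega
    refine (((Testable.eq_succ (N := N + 1 + 4 + 2) (x := N + 1 + 4) (y := N + 1 + 4 + 1) (by omega)
      (by omega)).and (hf (N + 1 + 4 + 2) ((N + 1) ::ᵥ ρ) (N + 1 + 4 + 1) hlt
        (by omega))).exists_agree).of_iff fun c => ?_
    have hlt' : ∀ i, ((N + 1) ::ᵥ ρ).get i < N + 1 + 4 :=
      get_cons_lt (by omega) fun i => by have := hρ i; omega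
    rw [← List.Vector.map_cons]
    constructor
    · rintro ⟨d, hd, h1, h2⟩
      rw [Part.mem_some_iff, h1] at h2
      rw [map_congr hd hlt', ← h2]
      omega
    · intro h
      let d := Function.update (Function.update c (N + 1 + 4)
        (f (((N + 1) ::ᵥ ρ).map c) - 1)) (N + 1 + 4 + 1) (f (((N + 1) ::ᵥ ρ).map c))
      have hd : AgreeBelow (N + 1 + 4) c d := (agreeBelow_update _ c le_rfl _).trans
        (agreeBelow_update _ _ (i := N + 1 + 4 + 1) (by omega) _)
      refine ⟨d, hd, ?_, ?_⟩
      · simp only [d, Function.update_self]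
        rw [Function.update_of_ne (by omega), Function.update_self]
        omega
      · rw [Part.mem_some_iff, ← map_congr hd hlt']
        simp [d]
  have hR : Testable (N + 1 + 4) fun c =>
      R c (c (N + 1), c (N + 1 + 1)) (c (N + 1 + 2), c (N + 1 + 3)) :=
    (Testable.eq_succ (by omega) (by omega)).and ((Testable.eq_zero (by omega)).and hne)
  have hcongr : ∀ c c', AgreeBelow (N + 1) c c' → R c = R c' := fun c c' h => by
    simp only [R, map_congr (h.mono (by omega)) hρ]
  have h := (((Testable.eq_zero (N := N + 1) (x := N) (by omega)).and
    (hf (N + 1) (y ::ᵥ ρ) N (get_cons_lt (by omega) fun i => by have := hρ i; omega)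
      (by omega))).and
    (Testable.reflTransGen hR hcongr (a := N) (a' := N) (b := y) (b' := N)
      (by omega) (by omega) (by omega) (by omega))).exists_agree
  refine h.of_iff fun c => ?_
  have key : ∀ (c : ℕ → ℕ) (k : ℕ), Relation.ReflTransGen (R c) (0, 0) (k, 0) ↔
      ∀ m < k, f (m ::ᵥ ρ.map c) ≠ 0 := by
    intro c k
    constructor
    · have : ∀ s, Relation.ReflTransGen (R c) (0, 0) s → ∀ m < s.1, f (m ::ᵥ ρ.map c) ≠ 0 := by
        intro s h
        induction h with
        | refl => intro m hm; exact absurd hm (Nat.not_lt_zero _)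
        | tail _ hs ih =>
          intro m hm
          rcases Nat.lt_succ_iff_lt_or_eq.1 (hs.1 ▸ hm) with hm | rfl
          · exact ih m hm
          · exact hs.2.2
      exact this _
    · intro h
      induction k with
      | zero => exact .refl
      | succ k ih => exact .tail (ih fun m hm => h m (by omega)) ⟨rfl, rfl, h k (by omega)⟩
  have hmem : ∀ c : ℕ → ℕ, (c y ∈ Nat.rfind fun k => Part.some (decide (f (k ::ᵥ ρ.map c) = 0))) ↔
      f (c y ::ᵥ ρ.map c) = 0 ∧ ∀ m < c y, f (m ::ᵥ ρ.map c) ≠ 0 := fun c => by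
    refine Nat.mem_rfind.trans ?_
    simp [Part.mem_some_iff, eq_comm]
  rw [hmem]
  constructor
  · rintro ⟨d, hd, ⟨h0, h1⟩, h2⟩
    rw [h0, key] at h2
    rw [Part.mem_some_iff, h0, List.Vector.map_cons] at h1
    rw [map_congr hd hρ, hd _ hy]
    exact ⟨h1.symm, h2⟩
  · intro h
    let d := Function.update c N 0
    have hd : AgreeBelow N c d := agreeBelow_update N c le_rfl 0
    have d0 : d N = 0 := by simp [d]
    rw [map_congr hd hρ, hd _ hy] at h
    refine ⟨d, hd, ⟨d0, ?_⟩, ?_⟩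
    · rw [Part.mem_some_iff, d0, List.Vector.map_cons]; exact h.1.symm
    · rw [d0, key]; exact h.2

theorem of_primrec {n : ℕ} {f : List.Vector ℕ n → ℕ} (hf : Nat.Primrec' f) :
    TestableFun fun v => Part.some (f v) := by
  induction hf with
  | zero => exact fun N ρ y _ hy => (Testable.eq_zero hy).of_iff fun c => by simp
  | succ =>
    intro N ρ y hρ hy
    refine (Testable.eq_succ (hρ 0) hy).of_iff fun c => ?_
    rw [Part.mem_some_iff]
    dsimp only
    rw [← List.Vector.get_zero, List.Vector.get_map]
  | get i =>
    intro N ρ y hρ hy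
    refine (Testable.eq hy (hρ i)).of_iff fun c => ?_
    rw [Part.mem_some_iff]
    dsimp only
    rw [List.Vector.get_map]
  | @comp m n f g _ _ ihf ihg =>
    have h := comp ihf ihg
    intro N ρ y hρ hy
    refine (h N ρ y hρ hy).of_iff fun c => ?_
    dsimp only
    rw [Vector.mOfFn_part_some]
    simp
  | prec _ _ ihf ihg => exact prec ihf ihg

theorem of_partrec {n : ℕ} {f : List.Vector ℕ n →. ℕ} (hf : Nat.Partrec' f) : TestableFun f := by
  induction hf with
  | prim hf => exact of_primrec hf
  | comp _ _ _ ihf ihg => exact comp ihf ihg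
  | rfind _ ih => exact rfind ih

end TestableFun

/-! Undecidability of counter machine reachability -/

/-- State `0` is reserved for the goal. The argument is in counter `0`, and the value is guessed in
counter `1`, so success means that some value exists. -/
theorem exists_machine {f : ℕ →. ℕ} (hf : Nat.Partrec f) : ∃ (L : CounterMachine) (a n : ℕ),
    (∀ x ∈ L, 0 < x.1 ∧ x.1 < n) ∧ ∀ M : CounterMachine,
      (∀ x, 0 < x.1 → x.1 < n → (x ∈ M ↔ x ∈ L)) →
      ∀ c, (∃ k, M.ReachesIn 0 k (a, c)) ↔ (f (c 0)).Dom := by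
  have h := TestableFun.of_partrec (Nat.Partrec'.part_iff₁.2 (Partrec.nat_iff.2 hf)) 2 (0 ::ᵥ List.Vector.nil) 1
    (TestableFun.get_cons_lt (by omega) fun i => i.elim0) (by omega)
  obtain ⟨-, S, iS, sS, tS⟩ := Testable.exists_agree (N := 1) 1 h
  obtain ⟨L, a, n, hn, hL, h⟩ := iS 1 0
  refine ⟨L, a, n, hL, fun M hM c => ?_⟩
  obtain ⟨h1, h2⟩ := h M 0 (by omega) hM
  constructor
  · rintro ⟨k, hk⟩
    obtain ⟨c', hc', -⟩ := h2 k c hk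
    obtain ⟨⟨d, hd, hd'⟩, -⟩ := sS _ _ hc'
    rw [hd 0 (by omega)]
    exact Part.dom_iff_mem.2 ⟨_, hd'⟩
  · intro hdom
    obtain ⟨y, hy⟩ := Part.dom_iff_mem.1 hdom
    obtain ⟨c', hc'⟩ := tS c ⟨Function.update c 1 y, agreeBelow_update 1 c le_rfl y, by
      simpa using hy⟩
    exact h1 _ _ hc' ⟨0, rfl⟩

theorem not_computablePred_cmReachability : ¬ ComputablePred CMReachability := by
  intro hcomp
  have hf : Nat.Partrec fun k => Nat.Partrec.Code.eval (Denumerable.ofNat _ k) 0 :=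
    Partrec.nat_iff.1 (Nat.Partrec.Code.eval_part.comp (Computable.ofNat _) (Computable.const 0))
  obtain ⟨L, a, n, hL, h⟩ := exists_machine hf
  -- The run starts with empty counters, so the input `k` is loaded by a chain of `k` increments
  -- leading down from state `n + 1 + k` to `n + 1`. The test of the still empty counter `1` acts as
  -- a jump to `a`. Starting the chain at `n + 1` keeps it away from the goal state `0` even if `n =
  -- 0`.
  let load : ℕ → CounterMachine := fun k =>
    L ++ (n + 1, .test 1, a) ::
      (List.range k).map fun j => (n + 1 + (j + 1), CounterOp.inc 0, n + 1 + j)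
  have hload : ∀ k x, x ∈ load k ↔ x ∈ L ∨ x = (n + 1, .test 1, a) ∨
      ∃ j < k, (n + 1 + (j + 1), CounterOp.inc 0, n + 1 + j) = x := by simp [load]
  have hreach : ∀ k, CMReachability (load k, n + 1 + k, 0) ↔
      (Nat.Partrec.Code.eval (Denumerable.ofNat _ k) 0).Dom := by
    intro k
    have hM : ∀ x, 0 < x.1 → x.1 < n → (x ∈ load k ↔ x ∈ L) := by
      intro x _ hx
      rw [hload]
      constructor
      · rintro (h | rfl | ⟨j, -, rfl⟩)
        · exact h
        · dsimp only at hx; omega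
        · dsimp only at hx; omega
      · exact .inl
    have h0 : ∀ c : ℕ → ℕ, c 1 = 0 → ((∃ m, (load k).ReachesIn 0 m (n + 1, c)) ↔
        ∃ m, (load k).ReachesIn 0 m (a, c)) := by
      intro c hc
      constructor
      · rintro ⟨_ | m, hm⟩
        · simp [CounterMachine.ReachesIn] at hm
        · obtain ⟨⟨q, c'⟩, ⟨ι, hι, he⟩, hm⟩ := hm
          rcases (hload _ _).1 hι with h | h | ⟨j, -, h⟩
          · have := (hL _ h).2; dsimp only at this; omega
          · simp only [Prod.mk.injEq] at h
            obtain ⟨-, rfl, rfl⟩ := h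
            obtain rfl : c' = c := funext he.2
            exact ⟨m, hm⟩
          · simp only [Prod.mk.injEq] at h; omega
      · rintro ⟨m, hm⟩
        exact ⟨m + 1, (a, c), ⟨.test 1, (hload _ _).2 (.inr (.inl rfl)), hc, fun _ => rfl⟩, hm⟩
    have hj : ∀ j ≤ k, ∀ c : ℕ → ℕ, c 1 = 0 → ((∃ m, (load k).ReachesIn 0 m (n + 1 + j, c)) ↔
        ∃ m, (load k).ReachesIn 0 m (a, Function.update c 0 (c 0 + j))) := by
      intro j
      induction j with
      | zero => intro _ c hc; simpa using h0 c hc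
      | succ j ih =>
        intro hjk c hc
        have ih := ih (by omega) (Function.update c 0 (c 0 + 1)) (by simpa using hc)
        simp only [Function.update_self, Function.update_idem] at ih
        rw [show c 0 + (j + 1) = c 0 + 1 + j by omega, ← ih]
        constructor
        · rintro ⟨_ | m, hm⟩
          · simp [CounterMachine.ReachesIn] at hm
          · obtain ⟨⟨q, c'⟩, ⟨ι, hι, he⟩, hm⟩ := hm
            rcases (hload _ _).1 hι with h | h | ⟨i, -, h⟩
            · have := (hL _ h).2; dsimp only at this; omega
            · simp only [Prod.mk.injEq] at h; omega
            · simp only [Prod.mk.injEq] at h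
              obtain ⟨hi, rfl, rfl⟩ := h
              obtain rfl : i = j := by omega
              obtain rfl : c' = Function.update c 0 (c 0 + 1) := funext fun l => by
                by_cases hl : l = 0
                · subst hl; simpa using he.1
                · exact (he.2 l hl).trans (by simp [hl])
              exact ⟨m, hm⟩
        · rintro ⟨m, hm⟩
          exact ⟨m + 1, _, ⟨.inc 0, (hload _ _).2 (.inr (.inr ⟨j, hjk, rfl⟩)), by simp,
            fun l hl => by simp [hl]⟩, hm⟩
    have := hj k le_rfl (fun _ => 0) rfl
    rw [h _ hM] at this
    rw [CMReachability, ← CounterMachine.exists_reachesIn_iff, this]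
    simp
  have hprim : Primrec fun k => ((load k, n + 1 + k, 0) : CounterMachine × ℕ × ℕ) := by
    refine Primrec.pair ?_ (Primrec.pair (Primrec.nat_add.comp (.const _) .id) (.const 0))
    refine Primrec.list_append.comp (.const L) (Primrec.list_cons.comp (.const _) ?_)
    refine Primrec.list_map Primrec.list_range ?_
    exact Primrec.to₂ (Primrec.pair (Primrec.nat_add.comp (.const _)
      (Primrec.succ.comp .snd)) (Primrec.pair (.const _) (Primrec.nat_add.comp (.const _) .snd)))
  refine ComputablePred.halting_problem 0 (ComputablePred.computable_of_manyOneReducible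
    ⟨fun c => (load (Encodable.encode c), n + 1 + Encodable.encode c, 0), ?_, fun c => ?_⟩ hcomp)
  · exact hprim.to_comp.comp Computable.encode
  · rw [hreach, Denumerable.ofNat_encode]

/-! The finite model property -/

/-- The propositional variables of a formula. -/
def Formula.vars : Formula → Set ℕ
  | .var p => {p}
  | .neg φ => φ.vars
  | .and φ ψ => φ.vars ∪ ψ.vars
  | .dia0 φ => φ.vars
  | .dia1 φ => φ.vars

theorem Formula.finite_vars (φ : Formula) : φ.vars.Finite := by
  induction φ with
  | var p => exact Set.finite_singleton p
  | neg φ ih => exact ih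
  | and φ ψ ih ih' => exact ih.union ih'
  | dia0 φ ih => exact ih
  | dia1 φ ih => exact ih

theorem truth_iff_of_bisimulation {F G : TwoFrame.{u}} {ν : ℕ → Set F.W} {ν' : ℕ → Set G.W}
    {V : Set ℕ} {Z : F.W → G.W → Prop}
    (hvar : ∀ w w', Z w w' → ∀ p ∈ V, w ∈ ν p ↔ w' ∈ ν' p)
    (forth0 : ∀ w w', Z w w' → ∀ v, F.R0 w v → ∃ v', G.R0 w' v' ∧ Z v v')
    (back0 : ∀ w w', Z w w' → ∀ v', G.R0 w' v' → ∃ v, F.R0 w v ∧ Z v v')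
    (forth1 : ∀ w w', Z w w' → ∀ v, F.R1 w v → ∃ v', G.R1 w' v' ∧ Z v v')
    (back1 : ∀ w w', Z w w' → ∀ v', G.R1 w' v' → ∃ v, F.R1 w v ∧ Z v v')
    (φ : Formula) (hφ : φ.vars ⊆ V) {w : F.W} {w' : G.W} (h : Z w w') :
    Truth F ν w φ ↔ Truth G ν' w' φ := by
  induction φ generalizing w w' with
  | var p => exact hvar w w' h p (hφ rfl)
  | neg φ ih => exact not_congr (ih hφ h)
  | and φ ψ ih ih' =>
    exact and_congr (ih (Set.subset_union_left.trans hφ) h) (ih' (Set.subset_union_right.trans hφ) h)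
  | dia0 φ ih =>
    constructor
    · rintro ⟨v, hv, ht⟩
      obtain ⟨v', hv', hz⟩ := forth0 w w' h v hv
      exact ⟨v', hv', (ih hφ hz).1 ht⟩
    · rintro ⟨v', hv', ht⟩
      obtain ⟨v, hv, hz⟩ := back0 w w' h v' hv'
      exact ⟨v, hv, (ih hφ hz).2 ht⟩
  | dia1 φ ih =>
    constructor
    · rintro ⟨v, hv, ht⟩
      obtain ⟨v', hv', hz⟩ := forth1 w w' h v hv
      exact ⟨v', hv', (ih hφ hz).1 ht⟩
    · rintro ⟨v', hv', ht⟩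
      obtain ⟨v, hv, hz⟩ := back1 w w' h v' hv'
      exact ⟨v, hv, (ih hφ hz).2 ht⟩

/-- For a map into a finite type, finitely many elements meet all fibres, and meet them twice
where this is possible. -/
theorem exists_finite_set_meeting_fibres {D X : Type*} [Finite X] (τ : D → X) :
    ∃ s : Set D, s.Finite ∧ ∀ e d, e ≠ d → ∃ e' ∈ s, e' ≠ d ∧ τ e' = τ e := by
  have h : ∀ x, ∃ s : Set D, s.Finite ∧ ∀ e d, e ≠ d → τ e = x → ∃ e' ∈ s, e' ≠ d ∧ τ e' = x := by
    intro x
    by_cases h₁ : ∃ e₁, τ e₁ = x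
    · obtain ⟨e₁, h₁⟩ := h₁
      by_cases h₂ : ∃ e₂, e₂ ≠ e₁ ∧ τ e₂ = x
      · obtain ⟨e₂, hne, h₂⟩ := h₂
        refine ⟨{e₁, e₂}, Set.toFinite _, fun e d _ _ => ?_⟩
        by_cases hd : e₁ = d
        · exact ⟨e₂, by simp, hd ▸ hne, h₂⟩
        · exact ⟨e₁, by simp, hd, h₁⟩
      · refine ⟨{e₁}, Set.toFinite _, fun e d hed he => ⟨e, ?_, hed, he⟩⟩
        by_contra hne
        exact h₂ ⟨e, hne, he⟩
    · exact ⟨∅, Set.finite_empty, fun e _ _ he => absurd ⟨e, he⟩ h₁⟩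
  choose s hs h using h
  refine ⟨⋃ x, s x, Set.finite_iUnion hs, fun e d hed => ?_⟩
  obtain ⟨e', he', h'⟩ := h (τ e) e d hed rfl
  exact ⟨e', Set.mem_iUnion.2 ⟨_, he'⟩, h'⟩

/-- The type `τ d` of a column records the variables of `φ` at every moment. Being at the same
moment in columns of equal type is a bisimulation between the given model and its restriction to the
chosen columns. -/
theorem satisfiable_finLin_diff_iff (φ : Formula) :
    Satisfiable.{u} (classProd finLinFrames diffFrames) φ ↔
      Satisfiable.{u} (classProd finLinFrames finDiffFrames) φ := by
  constructor
  · rintro ⟨_, ⟨F, hF, D, hD, rfl⟩, ν, ⟨t, d⟩, h⟩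
    have := hF.2
    have := φ.finite_vars.to_subtype
    let τ : D.W → (F.W → φ.vars → Prop) := fun d t p => (t, d) ∈ ν p
    obtain ⟨s, hs, hmeet⟩ := exists_finite_set_meeting_fibres τ
    have hsub : s ⊆ insert d s := Set.subset_insert d s
    let D' : Frame.{u} := ⟨(insert d s : Set D.W), ⟨d, Set.mem_insert d s⟩, fun x y => x ≠ y⟩
    refine ⟨F.prod D', ⟨F, hF, D', ⟨fun _ _ => Iff.rfl, (hs.insert d).to_subtype⟩, rfl⟩,
      fun p => {x | (x.1, x.2.1) ∈ ν p}, (t, ⟨d, Set.mem_insert d s⟩), ?_⟩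
    refine (truth_iff_of_bisimulation (V := φ.vars)
      (F := F.prod D) (G := F.prod D')
      (Z := fun (w : F.W × D.W) (w' : F.W × D'.W) => w.1 = w'.1 ∧ τ w.2 = τ w'.2.1) ?_ ?_ ?_ ?_ ?_ φ subset_rfl ⟨rfl, rfl⟩).1 h
    · rintro ⟨x, e⟩ ⟨_, e'⟩ ⟨rfl, he⟩ p hp
      exact iff_of_eq (congrFun (congrFun he x) ⟨p, hp⟩)
    · rintro ⟨x, e⟩ ⟨_, e'⟩ ⟨rfl, he⟩ ⟨y, _⟩ ⟨hR, rfl⟩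
      exact ⟨(y, e'), ⟨hR, rfl⟩, rfl, he⟩
    · rintro ⟨x, e⟩ ⟨_, e'⟩ ⟨rfl, he⟩ ⟨y, _⟩ ⟨hR, rfl⟩
      exact ⟨(y, e), ⟨hR, rfl⟩, rfl, he⟩
    · rintro ⟨x, e⟩ ⟨_, e'⟩ ⟨rfl, he⟩ ⟨_, a⟩ ⟨hR, rfl⟩
      have hne : e ≠ a := (hD _ _).1 hR
      obtain ⟨b, hb, hbe, hτ⟩ : ∃ b ∈ s, b ≠ e'.1 ∧ τ b = τ a := by
        -- If `a` is itself the column to be avoided, then `e` is another column of the same type,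
        -- and the chosen set contains one different from `e'`.
        by_cases ha : a = e'.1
        · obtain ⟨b, hb, h1, h2⟩ := hmeet e e'.1 (ha ▸ hne)
          exact ⟨b, hb, h1, by rw [h2, ha]; exact he⟩
        · exact hmeet a e'.1 ha
      exact ⟨(x, ⟨b, hsub hb⟩), ⟨fun h => hbe (congrArg Subtype.val h).symm, rfl⟩, rfl, hτ.symm⟩
    · rintro ⟨x, e⟩ ⟨_, e'⟩ ⟨rfl, he⟩ ⟨_, a⟩ ⟨hR, rfl⟩
      have hne : e'.1 ≠ a.1 := fun h => hR (Subtype.ext h)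
      -- If the move leads to `e` itself, `e'` answers it: it differs from `e` and has the same
      -- type.
      by_cases ha : a.1 = e
      · exact ⟨(x, e'.1), ⟨(hD _ _).2 (ha ▸ hne.symm), rfl⟩, rfl, by rw [ha]; exact he.symm⟩
      · exact ⟨(x, a.1), ⟨(hD _ _).2 (Ne.symm ha), rfl⟩, rfl, rfl⟩
  · rintro ⟨_, ⟨F, hF, D, hD, rfl⟩, h⟩
    exact ⟨_, ⟨F, hF, D, hD.1, rfl⟩, h⟩

/-! Recursive enumerability -/

theorem rePred_exists {α β : Type*} [Primcodable α] [Primcodable β] {R : α → β → Prop}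
    (hR : PrimrecRel R) : REPred fun a => ∃ b, R a b := by
  classical
  have h : Partrec fun a => Nat.rfindOpt fun n =>
      (Encodable.decode (α := β) n).bind fun b => if R a b then some () else none := by
    refine Partrec.rfindOpt (Primrec.to_comp (Primrec.option_bind
      (Primrec.decode.comp Primrec.snd) ?_))
    refine Primrec.ite ?_ (.const _) (.const _)
    exact hR.comp (Primrec.fst.comp Primrec.fst) Primrec.snd
  refine h.dom_re.of_eq fun a => ?_
  rw [Nat.rfindOpt_dom]
  constructor
  · rintro ⟨n, x, hx⟩
    obtain ⟨b, -, hb⟩ := Option.bind_eq_some_iff.1 hx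
    by_contra hcon
    rw [if_neg fun h => hcon ⟨b, h⟩] at hb
    cases hb
  · rintro ⟨b, hb⟩
    exact ⟨Encodable.encode b, (), by simp [hb]⟩

theorem primrecPred_forall_lt {α : Type*} [Primcodable α] {f : α → ℕ} {R : α → ℕ → Prop}
    (hf : Primrec f) (hR : PrimrecPred fun p : α × ℕ => R p.1 p.2) :
    PrimrecPred fun a => ∀ x < f a, R a x :=
  ((PrimrecRel.forall_mem_list (R := fun x a => R a x) (hR.comp (Primrec.pair Primrec.snd
    Primrec.fst))).comp (Primrec.list_range.comp hf) .id).of_eq fun a => by simp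

theorem primrecPred_exists_lt {α : Type*} [Primcodable α] {f : α → ℕ} {R : α → ℕ → Prop}
    (hf : Primrec f) (hR : PrimrecPred fun p : α × ℕ => R p.1 p.2) :
    PrimrecPred fun a => ∃ x < f a, R a x :=
  ((PrimrecRel.exists_mem_list (R := fun x a => R a x) (hR.comp (Primrec.pair Primrec.snd
    Primrec.fst))).comp (Primrec.list_range.comp hf) .id).of_eq fun a => by simp

theorem primrecPred_iff {α : Type*} [Primcodable α] {p q : α → Prop} (hp : PrimrecPred p)
    (hq : PrimrecPred q) : PrimrecPred fun a => p a ↔ q a :=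
  ((hp.and hq).or (hp.not.and hq.not)).of_eq fun a => by tauto

theorem primrecPred_imp {α : Type*} [Primcodable α] {p q : α → Prop} (hp : PrimrecPred p)
    (hq : PrimrecPred q) : PrimrecPred fun a => p a → q a :=
  (hp.not.or hq).of_eq fun a => by tauto

/-- A finite truth table: `TableEntry L x t d` says that the formula with Gödel number `x` is true
at `(t, d)` according to the list `L`. -/
def TableEntry (L : List ℕ) (x t d : ℕ) : Prop := Nat.pair x (Nat.pair t d) ∈ L

/-- The table `L` obeys the truth conditions at the entry `(x, t, d)`, for the product of the
strict order on `n` points and the difference frame on `m` points. -/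
def LocallyCorrect (n m : ℕ) (L : List ℕ) (x t d : ℕ) : Prop :=
  (x % 5 = 1 → (TableEntry L x t d ↔ ¬ TableEntry L (x / 5) t d)) ∧
  (x % 5 = 2 → (TableEntry L x t d ↔
    TableEntry L (x / 5).unpair.1 t d ∧ TableEntry L (x / 5).unpair.2 t d)) ∧
  (x % 5 = 3 → (TableEntry L x t d ↔ ∃ t' < n, t < t' ∧ TableEntry L (x / 5) t' d)) ∧
  (x % 5 = 4 → (TableEntry L x t d ↔ ∃ d' < m, d ≠ d' ∧ TableEntry L (x / 5) t d'))

/-- `c = (n, m, L)` certifies the satisfiability of the formula with Gödel number `x`. -/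
def Certificate (x : ℕ) (c : ℕ × ℕ × List ℕ) : Prop :=
  (∀ y < x + 1, ∀ t < c.1, ∀ d < c.2.1, LocallyCorrect c.1 c.2.1 c.2.2 y t d) ∧
    ∃ t < c.1, ∃ d < c.2.1, TableEntry c.2.2 x t d

theorem primrecPred_tableEntry {α : Type*} [Primcodable α] {L : α → List ℕ} {x t d : α → ℕ}
    (hL : Primrec L) (hx : Primrec x) (ht : Primrec t) (hd : Primrec d) :
    PrimrecPred fun a => TableEntry (L a) (x a) (t a) (d a) :=
  ((PrimrecRel.exists_mem_list (R := fun y z : ℕ => y = z) Primrec.eq).comp hL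
    (Primrec₂.natPair.comp hx (Primrec₂.natPair.comp ht hd))).of_eq fun a => by
      simp [TableEntry]

theorem primrecRel_certificate : PrimrecRel Certificate := by
  have hloc : PrimrecPred fun a : (((ℕ × ℕ × ℕ × List ℕ) × ℕ) × ℕ) × ℕ =>
      LocallyCorrect a.1.1.1.2.1 a.1.1.1.2.2.1 a.1.1.1.2.2.2 a.1.1.2 a.1.2 a.2 := by
    have hd := Primrec.snd (α := ((ℕ × ℕ × ℕ × List ℕ) × ℕ) × ℕ) (β := ℕ)
    have h1 := Primrec.fst (α := ((ℕ × ℕ × ℕ × List ℕ) × ℕ) × ℕ) (β := ℕ)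
    have ht := Primrec.snd.comp h1
    have hx := Primrec.snd.comp (Primrec.fst.comp h1)
    have h4 := Primrec.snd.comp (Primrec.fst.comp (Primrec.fst.comp h1))
    have hn := Primrec.fst.comp h4
    have hm := Primrec.fst.comp (Primrec.snd.comp h4)
    have hL := Primrec.snd.comp (Primrec.snd.comp h4)
    have hx5 := Primrec.nat_div.comp hx (.const 5)
    have hmod : ∀ k, PrimrecPred fun a : (((ℕ × ℕ × ℕ × List ℕ) × ℕ) × ℕ) × ℕ =>
        a.1.1.2 % 5 = k := fun k =>
      Primrec.eq.comp (Primrec.nat_mod.comp hx (.const 5)) (.const k)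
    have hE := primrecPred_tableEntry hL hx ht hd
    refine (primrecPred_imp (hmod 1) (primrecPred_iff hE
      (primrecPred_tableEntry hL hx5 ht hd).not)).and ((primrecPred_imp (hmod 2)
      (primrecPred_iff hE ((primrecPred_tableEntry hL (Primrec.fst.comp (Primrec.unpair.comp hx5))
        ht hd).and (primrecPred_tableEntry hL (Primrec.snd.comp (Primrec.unpair.comp hx5))
        ht hd)))).and ((primrecPred_imp (hmod 3) (primrecPred_iff hE
        (primrecPred_exists_lt hn ?_))).and (primrecPred_imp (hmod 4) (primrecPred_iff hE
        (primrecPred_exists_lt hm ?_)))))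
    · exact (Primrec.nat_lt.comp (ht.comp .fst) .snd).and (primrecPred_tableEntry (hL.comp .fst)
        (hx5.comp .fst) .snd (hd.comp .fst))
    · exact (Primrec.eq.comp (hd.comp .fst) .snd).not.and (primrecPred_tableEntry (hL.comp .fst)
        (hx5.comp .fst) (ht.comp .fst) .snd)
  have hn := Primrec.fst.comp (Primrec.snd (α := ℕ) (β := ℕ × ℕ × List ℕ))
  have hm := Primrec.fst.comp (Primrec.snd.comp (Primrec.snd (α := ℕ) (β := ℕ × ℕ × List ℕ)))
  have hL := Primrec.snd.comp (Primrec.snd.comp (Primrec.snd (α := ℕ) (β := ℕ × ℕ × List ℕ)))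
  refine (primrecPred_forall_lt (Primrec.succ.comp .fst) (primrecPred_forall_lt (hn.comp .fst)
    (primrecPred_forall_lt (hm.comp (Primrec.fst.comp .fst)) hloc))).and
    (primrecPred_exists_lt hn (primrecPred_exists_lt (hm.comp .fst) ?_))
  exact primrecPred_tableEntry (hL.comp (Primrec.fst.comp .fst))
    (Primrec.fst.comp (Primrec.fst.comp .fst)) (Primrec.snd.comp .fst) .snd

theorem exists_equiv_fin_of_finLin {F : Frame.{u}} (hF : F ∈ finLinFrames) :
    ∃ (n : ℕ) (e : F.W ≃ Fin n), ∀ s t, F.R s t ↔ e s < e t := by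
  classical
  obtain ⟨⟨h1, h2, h3⟩, h4⟩ := hF
  have : Fintype F.W := Fintype.ofFinite _
  have : IsStrictTotalOrder F.W F.R :=
    { irrefl := h1, trans := h2, trichotomous := fun a b h h' => by
        rcases h3 a b with h'' | h'' | h''
        exacts [absurd h'' h, h'', absurd h'' h'] }
  let : LinearOrder F.W := linearOrderOfSTO F.R
  exact ⟨_, (Fintype.orderIsoFinOfCardEq F.W rfl).symm.toEquiv, fun s t =>
    ((Fintype.orderIsoFinOfCardEq F.W rfl).symm.lt_iff_lt (x := s) (y := t)).symm⟩

/-- Components of a formula have smaller codes, so the table is needed only up to the code of `φ`.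
Every number is the code of a formula, so all these rows make sense. Rows with code divisible by `5`
are unconstrained: they are the valuation. -/
theorem exists_certificate_iff (φ : Formula) :
    (∃ c, Certificate φ.toNat c) ↔
      Satisfiable.{u} (classProd finLinFrames finDiffFrames) φ := by
  constructor
  · rintro ⟨⟨n, m, L⟩, hloc, t₀, ht₀, d₀, hd₀, h₀⟩
    dsimp only at hloc ht₀ hd₀ h₀
    let F : Frame.{u} := ⟨ULift (Fin n), ⟨⟨t₀, ht₀⟩⟩, fun s t => s.down < t.down⟩
    let D : Frame.{u} := ⟨ULift (Fin m), ⟨⟨d₀, hd₀⟩⟩, fun s t => s ≠ t⟩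
    have hF : F ∈ finLinFrames := by
      refine ⟨⟨fun x => lt_irrefl x.down, fun x y z => lt_trans (a := x.down), fun x y => ?_⟩,
        inferInstanceAs (Finite (ULift (Fin n)))⟩
      rcases lt_trichotomy x.down y.down with h | h | h
      exacts [.inl h, .inr (.inl (ULift.ext _ _ h)), .inr (.inr h)]
    have hD : D ∈ finDiffFrames := ⟨fun _ _ => Iff.rfl, inferInstanceAs (Finite (ULift (Fin m)))⟩
    let ν : ℕ → Set (F.prod D).W := fun p => {w | TableEntry L (5 * p) w.1.down w.2.down}
    have key : ∀ ψ : Formula, ψ.toNat ≤ φ.toNat → ∀ (t : Fin n) (d : Fin m),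
        Truth (F.prod D) ν (⟨t⟩, ⟨d⟩) ψ ↔ TableEntry L ψ.toNat t d := by
      intro ψ
      induction ψ with
      | var p => exact fun _ _ _ => Iff.rfl
      | neg ψ ih =>
        intro hψ t d
        obtain ⟨h1, -⟩ := hloc _ (Nat.lt_succ_of_le hψ) t t.2 d d.2
        simp only [Formula.toNat] at h1 hψ ⊢
        rw [h1 (by omega), show (5 * ψ.toNat + 1) / 5 = ψ.toNat by omega]
        exact not_congr (ih (by omega) t d)
      | and ψ χ ih ih' =>
        intro hψ t d
        obtain ⟨-, h1, -⟩ := hloc _ (Nat.lt_succ_of_le hψ) t t.2 d d.2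
        simp only [Formula.toNat] at h1 hψ ⊢
        rw [h1 (by omega), show (5 * Nat.pair ψ.toNat χ.toNat + 2) / 5 =
          Nat.pair ψ.toNat χ.toNat by omega, Nat.unpair_pair]
        have := Nat.left_le_pair ψ.toNat χ.toNat
        have := Nat.right_le_pair ψ.toNat χ.toNat
        exact and_congr (ih (by omega) t d) (ih' (by omega) t d)
      | dia0 ψ ih =>
        intro hψ t d
        obtain ⟨-, -, h1, -⟩ := hloc _ (Nat.lt_succ_of_le hψ) t t.2 d d.2
        simp only [Formula.toNat] at h1 hψ ⊢
        rw [h1 (by omega), show (5 * ψ.toNat + 3) / 5 = ψ.toNat by omega]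
        constructor
        · rintro ⟨⟨⟨s⟩, _⟩, ⟨hs, rfl⟩, h⟩
          exact ⟨s, s.2, hs, (ih (by omega) s d).1 h⟩
        · rintro ⟨s, hs, hts, h⟩
          exact ⟨(⟨⟨s, hs⟩⟩, ⟨d⟩), ⟨hts, rfl⟩, (ih (by omega) ⟨s, hs⟩ d).2 h⟩
      | dia1 ψ ih =>
        intro hψ t d
        obtain ⟨-, -, -, h1⟩ := hloc _ (Nat.lt_succ_of_le hψ) t t.2 d d.2
        simp only [Formula.toNat] at h1 hψ ⊢
        rw [h1 (by omega), show (5 * ψ.toNat + 4) / 5 = ψ.toNat by omega]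
        constructor
        · rintro ⟨⟨_, ⟨e⟩⟩, ⟨he, rfl⟩, h⟩
          exact ⟨e, e.2, fun hde => he (ULift.ext _ _ (Fin.ext hde)), (ih (by omega) t e).1 h⟩
        · rintro ⟨e, he, hde, h⟩
          exact ⟨(⟨t⟩, ⟨⟨e, he⟩⟩), ⟨fun h => hde (congrArg (fun z => z.down.1) h), rfl⟩,
            (ih (by omega) t ⟨e, he⟩).2 h⟩
    exact ⟨_, ⟨F, hF, D, hD, rfl⟩, ν, _, (key φ le_rfl ⟨t₀, ht₀⟩ ⟨d₀, hd₀⟩).2 h₀⟩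
  · rintro ⟨_, ⟨F, hF, D, hD, rfl⟩, ν, ⟨t₀, d₀⟩, h₀⟩
    obtain ⟨n, e, he⟩ := exists_equiv_fin_of_finLin hF
    have := hD.2
    obtain ⟨m, ⟨g⟩⟩ := Finite.exists_equiv_fin D.W
    let S : Set ℕ := {z | ∃ (y : ℕ) (t : Fin n) (d : Fin m), y ≤ φ.toNat ∧
      z = Nat.pair y (Nat.pair t d) ∧ Truth (F.prod D) ν (e.symm t, g.symm d) (Formula.ofNat y)}
    have hS : S.Finite := by
      refine (Set.finite_range (fun x : Fin (φ.toNat + 1) × Fin n × Fin m =>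
        Nat.pair x.1 (Nat.pair x.2.1 x.2.2))).subset ?_
      rintro _ ⟨y, t, d, hy, rfl, -⟩
      exact ⟨(⟨y, by omega⟩, t, d), rfl⟩
    have hE : ∀ y ≤ φ.toNat, ∀ (t : Fin n) (d : Fin m), TableEntry hS.toFinset.toList y t d ↔
        Truth (F.prod D) ν (e.symm t, g.symm d) (Formula.ofNat y) := by
      intro y hy t d
      rw [TableEntry, Finset.mem_toList, Set.Finite.mem_toFinset]
      constructor
      · rintro ⟨y', t', d', -, heq, h⟩
        simp only [Nat.pair_eq_pair, Fin.val_inj] at heq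
        obtain ⟨rfl, rfl, rfl⟩ := heq
        exact h
      · exact fun h => ⟨y, t, d, hy, rfl, h⟩
    refine ⟨(n, m, hS.toFinset.toList), ?_, e t₀, (e t₀).2, g d₀, (g d₀).2, ?_⟩
    · intro y hy t ht d hd
      dsimp only at ht hd ⊢
      lift t to Fin n using ht
      lift d to Fin m using hd
      have hdiv : y / 5 ≤ φ.toNat := by omega
      have hl := (Nat.unpair_left_le (y / 5)).trans hdiv
      have hr := (Nat.unpair_right_le (y / 5)).trans hdiv
      refine ⟨fun h => ?_, fun h => ?_, fun h => ?_, fun h => ?_⟩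
      · rw [hE _ (by omega), hE _ hdiv, Formula.ofNat, if_neg (by omega), if_pos h]
        exact Iff.rfl
      · rw [hE _ (by omega), hE _ hl, hE _ hr, Formula.ofNat, if_neg (by omega), if_neg (by omega),
          if_pos h]
        exact Iff.rfl
      · rw [hE _ (by omega), Formula.ofNat, if_neg (by omega), if_neg (by omega),
          if_neg (by omega), if_pos h]
        constructor
        · rintro ⟨⟨s, _⟩, ⟨hs, rfl⟩, hT⟩
          have hlt := (he _ _).1 hs
          rw [Equiv.apply_symm_apply] at hlt
          refine ⟨e s, (e s).2, hlt, (hE _ hdiv _ _).2 ?_⟩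
          rw [Equiv.symm_apply_apply]
          exact hT
        · rintro ⟨s, hs, hlt, hT⟩
          lift s to Fin n using hs
          exact ⟨(e.symm s, g.symm d), ⟨(he _ _).2 (by simpa using hlt), rfl⟩,
            (hE _ hdiv _ _).1 hT⟩
      · rw [hE _ (by omega), Formula.ofNat, if_neg (by omega), if_neg (by omega),
          if_neg (by omega), if_neg (by omega)]
        constructor
        · rintro ⟨⟨_, a⟩, ⟨ha, rfl⟩, hT⟩
          have hne := (hD.1 _ _).1 ha
          refine ⟨g a, (g a).2, fun h => hne ?_, (hE _ hdiv _ _).2 ?_⟩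
          · rw [Fin.ext h]; simp
          · rw [Equiv.symm_apply_apply]
            exact hT
        · rintro ⟨a, ha, hne, hT⟩
          lift a to Fin m using ha
          exact ⟨(e.symm t, g.symm a), ⟨(hD.1 _ _).2 (fun h => hne (by
            rw [g.symm.injective h])), rfl⟩, (hE _ hdiv _ _).1 hT⟩
    · rw [hE _ le_rfl, Formula.ofNat_toNat, Equiv.symm_apply_apply, Equiv.symm_apply_apply]
      exact h₀

theorem Formula.primrec_toNat : Primrec Formula.toNat :=
  Primrec.of_equiv (e := Formula.equivNat)

theorem rePred_satisfiable_finLin_diff :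
    REPred (Satisfiable.{u} (classProd finLinFrames diffFrames)) := by
  refine (rePred_exists (R := fun φ c => Certificate (Formula.toNat φ) c) ?_).of_eq fun φ => ?_
  · exact primrecRel_certificate.comp (Formula.primrec_toNat.comp .fst) .snd
  · rw [exists_certificate_iff, satisfiable_finLin_diff_iff]

namespace Formula

/-! Derived connectives -/

def top : Formula := neg (and (var 0) (neg (var 0)))

def or (φ ψ : Formula) : Formula := neg (and (neg φ) (neg ψ))

def imp (φ ψ : Formula) : Formula := neg (and φ (neg ψ))

def box0 (φ : Formula) : Formula := neg (dia0 (neg φ))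

def box1 (φ : Formula) : Formula := neg (dia1 (neg φ))

/-- Truth at all points of a difference frame. -/
def everywhere (φ : Formula) : Formula := and φ (box1 φ)

/-- Truth at some point of a difference frame. -/
def somewhere (φ : Formula) : Formula := or φ (dia1 φ)

/-- Truth at exactly one point of a difference frame. -/
def unique (φ : Formula) : Formula := somewhere (and φ (neg (dia1 φ)))

/-- Truth at all points, at present and at all later times. -/
def always (φ : Formula) : Formula := and (everywhere φ) (box0 (everywhere φ))

def bigAnd (l : List Formula) : Formula := l.foldr and top

def bigOr (l : List Formula) : Formula := neg (bigAnd (l.map neg))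

/-! Primitive recursiveness of the connectives -/

theorem primrec_iff_toNat {α : Type*} [Primcodable α] {f : α → Formula} :
    Primrec (fun a => (f a).toNat) ↔ Primrec f :=
  Primrec.of_equiv_iff equivNat

section

variable {α : Type*} [Primcodable α] {f g : α → Formula}

theorem primrec_var {f : α → ℕ} (hf : Primrec f) : Primrec fun a => var (f a) :=
  primrec_iff_toNat.1 (Primrec.nat_mul.comp (.const 5) hf)

theorem primrec_neg (hf : Primrec f) : Primrec fun a => neg (f a) :=
  primrec_iff_toNat.1 (Primrec.nat_add.comp (Primrec.nat_mul.comp (.const 5)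
    (primrec_iff_toNat.2 hf)) (.const 1))

theorem primrec_and (hf : Primrec f) (hg : Primrec g) : Primrec fun a => and (f a) (g a) :=
  primrec_iff_toNat.1 (Primrec.nat_add.comp (Primrec.nat_mul.comp (.const 5)
    (Primrec₂.natPair.comp (primrec_iff_toNat.2 hf) (primrec_iff_toNat.2 hg))) (.const 2))

theorem primrec_dia0 (hf : Primrec f) : Primrec fun a => dia0 (f a) :=
  primrec_iff_toNat.1 (Primrec.nat_add.comp (Primrec.nat_mul.comp (.const 5)
    (primrec_iff_toNat.2 hf)) (.const 3))

theorem primrec_dia1 (hf : Primrec f) : Primrec fun a => dia1 (f a) :=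
  primrec_iff_toNat.1 (Primrec.nat_add.comp (Primrec.nat_mul.comp (.const 5)
    (primrec_iff_toNat.2 hf)) (.const 4))

theorem primrec_or (hf : Primrec f) (hg : Primrec g) : Primrec fun a => or (f a) (g a) :=
  primrec_neg (primrec_and (primrec_neg hf) (primrec_neg hg))

theorem primrec_imp (hf : Primrec f) (hg : Primrec g) : Primrec fun a => imp (f a) (g a) :=
  primrec_neg (primrec_and hf (primrec_neg hg))

theorem primrec_box0 (hf : Primrec f) : Primrec fun a => box0 (f a) :=
  primrec_neg (primrec_dia0 (primrec_neg hf))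

theorem primrec_box1 (hf : Primrec f) : Primrec fun a => box1 (f a) :=
  primrec_neg (primrec_dia1 (primrec_neg hf))

theorem primrec_everywhere (hf : Primrec f) : Primrec fun a => everywhere (f a) :=
  primrec_and hf (primrec_box1 hf)

theorem primrec_somewhere (hf : Primrec f) : Primrec fun a => somewhere (f a) :=
  primrec_or hf (primrec_dia1 hf)

theorem primrec_unique (hf : Primrec f) : Primrec fun a => unique (f a) :=
  primrec_somewhere (primrec_and hf (primrec_neg (primrec_dia1 hf)))

theorem primrec_always (hf : Primrec f) : Primrec fun a => always (f a) :=
  primrec_and (primrec_everywhere hf) (primrec_box0 (primrec_everywhere hf))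

theorem primrec_bigAnd {l : α → List Formula} (hl : Primrec l) : Primrec fun a => bigAnd (l a) :=
  Primrec.list_foldr hl (.const top)
    (Primrec.to₂ (primrec_and (Primrec.fst.comp .snd) (Primrec.snd.comp .snd)))

theorem primrec_bigOr {l : α → List Formula} (hl : Primrec l) : Primrec fun a => bigOr (l a) :=
  primrec_neg (primrec_bigAnd (Primrec.list_map hl (Primrec.to₂ (primrec_neg .snd))))

end

end Formula

/-! Truth in products with difference frames -/

/-- Truth at `(t, d)` in a product, for the valuation given by the relations `v p`. -/
def Holds (F D : Frame.{u}) (v : ℕ → F.W → D.W → Prop) (t : F.W) (d : D.W) (φ : Formula) : Prop :=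
  Truth (F.prod D) (fun p => {w | v p w.1 w.2}) (t, d) φ

section

open Formula

variable {F D : Frame.{u}} {v : ℕ → F.W → D.W → Prop} {t : F.W} {d : D.W} {φ ψ : Formula}

theorem holds_var {p : ℕ} : Holds F D v t d (var p) ↔ v p t d := Iff.rfl

theorem holds_neg : Holds F D v t d (neg φ) ↔ ¬ Holds F D v t d φ := Iff.rfl

theorem holds_and : Holds F D v t d (φ.and ψ) ↔ Holds F D v t d φ ∧ Holds F D v t d ψ := Iff.rfl

theorem holds_top : Holds F D v t d top := fun h => h.2 h.1

theorem holds_or : Holds F D v t d (φ.or ψ) ↔ Holds F D v t d φ ∨ Holds F D v t d ψ := by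
  simp only [Formula.or, holds_neg, holds_and]; tauto

theorem holds_imp : Holds F D v t d (φ.imp ψ) ↔ (Holds F D v t d φ → Holds F D v t d ψ) := by
  simp only [imp, holds_neg, holds_and]; tauto

theorem holds_bigAnd {l : List Formula} :
    Holds F D v t d (bigAnd l) ↔ ∀ φ ∈ l, Holds F D v t d φ := by
  induction l with
  | nil => simpa [bigAnd] using holds_top
  | cons φ l ih =>
    rw [List.forall_mem_cons, ← ih]
    exact Iff.rfl

theorem holds_bigOr {l : List Formula} :
    Holds F D v t d (bigOr l) ↔ ∃ φ ∈ l, Holds F D v t d φ := by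
  simp only [bigOr, holds_neg, holds_bigAnd]
  simp [holds_neg]

theorem holds_dia0 : Holds F D v t d (dia0 φ) ↔ ∃ s, F.R t s ∧ Holds F D v s d φ := by
  constructor
  · rintro ⟨⟨s, _⟩, ⟨hs, rfl⟩, h⟩
    exact ⟨s, hs, h⟩
  · rintro ⟨s, hs, h⟩
    exact ⟨(s, d), ⟨hs, rfl⟩, h⟩

theorem holds_box0 : Holds F D v t d (box0 φ) ↔ ∀ s, F.R t s → Holds F D v s d φ := by
  rw [box0, holds_neg, holds_dia0]
  simp [holds_neg]

theorem holds_dia1 (hD : D ∈ diffFrames) :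
    Holds F D v t d (dia1 φ) ↔ ∃ e, d ≠ e ∧ Holds F D v t e φ := by
  constructor
  · rintro ⟨⟨_, e⟩, ⟨he, rfl⟩, h⟩
    exact ⟨e, (hD _ _).1 he, h⟩
  · rintro ⟨e, he, h⟩
    exact ⟨(t, e), ⟨(hD _ _).2 he, rfl⟩, h⟩

theorem holds_somewhere (hD : D ∈ diffFrames) :
    Holds F D v t d (somewhere φ) ↔ ∃ e, Holds F D v t e φ := by
  rw [somewhere, holds_or, holds_dia1 hD]
  constructor
  · rintro (h | ⟨e, -, h⟩)
    exacts [⟨d, h⟩, ⟨e, h⟩]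
  · rintro ⟨e, h⟩
    by_cases he : d = e
    · exact .inl (he ▸ h)
    · exact .inr ⟨e, he, h⟩

theorem holds_everywhere (hD : D ∈ diffFrames) :
    Holds F D v t d (everywhere φ) ↔ ∀ e, Holds F D v t e φ := by
  rw [everywhere, holds_and, box1, holds_neg, holds_dia1 hD]
  constructor
  · rintro ⟨h, h'⟩ e
    by_cases he : d = e
    · exact he ▸ h
    · by_contra hn
      exact h' ⟨e, he, hn⟩
  · exact fun h => ⟨h d, fun ⟨e, _, hn⟩ => hn (h e)⟩

theorem holds_unique (hD : D ∈ diffFrames) :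
    Holds F D v t d (unique φ) ↔ ∃ e, ∀ e', Holds F D v t e' φ ↔ e' = e := by
  rw [unique, holds_somewhere hD]
  refine exists_congr fun e => ?_
  rw [holds_and, holds_neg, holds_dia1 hD]
  constructor
  · rintro ⟨h, h'⟩ e'
    refine ⟨fun he' => ?_, fun he' => he' ▸ h⟩
    by_contra hne
    exact h' ⟨e', Ne.symm hne, he'⟩
  · exact fun h => ⟨(h e).2 rfl, fun ⟨e', hne, he'⟩ => hne ((h e').1 he').symm⟩

theorem holds_always (hD : D ∈ diffFrames) :
    Holds F D v t d (always φ) ↔ ∀ s, t = s ∨ F.R t s → ∀ e, Holds F D v s e φ := by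
  rw [always, holds_and, holds_box0, holds_everywhere hD]
  simp only [holds_everywhere hD]
  constructor
  · rintro ⟨h, h'⟩ s (rfl | hs) e
    exacts [h e, h' s hs e]
  · exact fun h => ⟨h t (.inl rfl), fun s hs => h s (.inr hs)⟩

end

/-! The formula that describes accepting runs -/

instance : DecidableEq CounterOp := CounterOp.equivSum.decidableEq

/-- The counter on which an operation acts. -/
def CounterOp.index : CounterOp → ℕ
  | .inc i => i
  | .dec i => i
  | .test i => i

namespace RunFormula

open Formula

/-- True at `(t, d)` for at most one `d` per time: marks the successor of a point of time. -/
def tick : Formula := var (Nat.pair 0 0)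

/-- The machine is in state `q`. -/
def state (q : ℕ) : Formula := var (Nat.pair 1 q)

/-- The element has been added to counter `i`. -/
def added (i : ℕ) : Formula := var (Nat.pair 2 i)

/-- The element has been removed from counter `i`. -/
def removed (i : ℕ) : Formula := var (Nat.pair 3 i)

/-- The element is being added to counter `i`. -/
def adding (i : ℕ) : Formula := var (Nat.pair 4 i)

/-- The element is being removed from counter `i`. -/
def removing (i : ℕ) : Formula := var (Nat.pair 5 i)

/-- `χ` holds from the point of time on that follows the one where `η` holds. -/
def growth (χ η : Formula) : Formula :=
  and (imp χ (box0 χ)) (and (imp η (and (neg χ) (box0 χ)))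
    (imp (and (neg χ) (dia0 χ)) (or η (dia0 η))))

/-- Counters start empty. The last two clauses, together with `growth`, ensure that a token being
added is outside the counter and becomes a member, and that a token being removed is a member. -/
def counterLaw (i : ℕ) : Formula :=
  and (everywhere (and (neg (added i)) (neg (removed i))))
    (always (and (and (growth (added i) (adding i)) (growth (removed i) (removing i)))
      (and (imp (adding i) (neg (removed i))) (imp (removing i) (added i)))))

/-- The effect of the operation `ι` on counter `j`. -/
def opLaw (ι : CounterOp) (j : ℕ) : Formula :=
  and (if ι = .inc j then unique (adding j) else everywhere (neg (adding j)))
    (and (if ι = .dec j then unique (removing j) else everywhere (neg (removing j)))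
      (if ι = .test j then everywhere (imp (added j) (removed j)) else top))

/-- There is a next point of time, and the state is then `q`. -/
def nextState (q : ℕ) : Formula :=
  somewhere (and (dia0 (and tick (state q))) (neg (dia0 (dia0 tick))))

/-- In state `q`, some instruction of `M` is performed. -/
def stateLaw (M : CounterMachine) (q : ℕ) : Formula :=
  always (imp (state q) (bigOr (M.map fun x => if x.1 = q then
    and (bigAnd ((M.map fun y => y.2.1.index).map (opLaw x.2.1))) (nextState x.2.2) else neg top)))

/-- Some run of `M` from state `q₀` with empty counters reaches `qᵣ`. -/
def runFormula (x : CounterMachine × ℕ × ℕ) : Formula :=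
  and (state x.2.1) (and (bigAnd ((x.1.map fun y => y.2.1.index).map counterLaw))
    -- A run can only visit its initial state and targets of instructions. The goal state gets no
    -- law, so time may end there and only there.
    (bigAnd ((x.2.1 :: x.1.map fun y => y.2.2).map fun q =>
      if q = x.2.2 then top else stateLaw x.1 q)))

/-! Primitive recursiveness -/

theorem primrec_inc : Primrec CounterOp.inc :=
  (Primrec.of_equiv_symm (e := CounterOp.equivSum)).comp Primrec.sumInl

theorem primrec_dec : Primrec CounterOp.dec :=
  (Primrec.of_equiv_symm (e := CounterOp.equivSum)).comp (Primrec.sumInr.comp Primrec.sumInl)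

theorem primrec_test : Primrec CounterOp.test :=
  (Primrec.of_equiv_symm (e := CounterOp.equivSum)).comp (Primrec.sumInr.comp Primrec.sumInr)

theorem primrec_index : Primrec CounterOp.index := by
  have h : Primrec fun s : ℕ ⊕ ℕ ⊕ ℕ => (Sum.casesOn s id fun s' => Sum.casesOn s' id id : ℕ) :=
    Primrec.sumCasesOn .id (Primrec.to₂ .snd)
      (Primrec.to₂ (Primrec.sumCasesOn .snd (Primrec.to₂ .snd) (Primrec.to₂ .snd)))
  exact (h.comp (Primrec.of_equiv (e := CounterOp.equivSum))).of_eq fun ι => by cases ι <;> rfl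

section

variable {α : Type*} [Primcodable α]

theorem primrec_letter (k : ℕ) {f : α → ℕ} (hf : Primrec f) :
    Primrec fun a => var (Nat.pair k (f a)) :=
  primrec_var (Primrec₂.natPair.comp (.const k) hf)

theorem primrec_growth {f g : α → Formula} (hf : Primrec f) (hg : Primrec g) :
    Primrec fun a => growth (f a) (g a) :=
  primrec_and (primrec_imp hf (primrec_box0 hf)) (primrec_and (primrec_imp hg
    (primrec_and (primrec_neg hf) (primrec_box0 hf))) (primrec_imp (primrec_and (primrec_neg hf)
      (primrec_dia0 hf)) (primrec_or hg (primrec_dia0 hg))))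

theorem primrec_counterLaw : Primrec counterLaw := by
  have h := fun k => primrec_letter k (Primrec.id (α := ℕ))
  exact primrec_and (primrec_everywhere (primrec_and (primrec_neg (h 2)) (primrec_neg (h 3))))
    (primrec_always (primrec_and (primrec_and (primrec_growth (h 2) (h 4))
      (primrec_growth (h 3) (h 5))) (primrec_and (primrec_imp (h 4) (primrec_neg (h 3)))
        (primrec_imp (h 5) (h 2)))))

theorem primrec_opLaw : Primrec₂ opLaw := by
  have h := fun k => primrec_letter k (Primrec.snd (α := CounterOp) (β := ℕ))
  have hi := Primrec.fst (α := CounterOp) (β := ℕ)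
  refine primrec_and (Primrec.ite (Primrec.eq.comp hi (primrec_inc.comp .snd))
    (primrec_unique (h 4)) (primrec_everywhere (primrec_neg (h 4)))) (primrec_and
      (Primrec.ite (Primrec.eq.comp hi (primrec_dec.comp .snd)) (primrec_unique (h 5))
        (primrec_everywhere (primrec_neg (h 5)))) (Primrec.ite (Primrec.eq.comp hi
          (primrec_test.comp .snd)) (primrec_everywhere (primrec_imp (h 2) (h 3))) (.const top)))

theorem primrec_nextState : Primrec nextState :=
  primrec_somewhere (primrec_and (primrec_dia0 (primrec_and (.const tick)
    (primrec_letter 1 .id))) (.const (neg (dia0 (dia0 tick)))))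

theorem primrec_indices {f : α → CounterMachine} (hf : Primrec f) :
    Primrec fun a => (f a).map fun y => y.2.1.index :=
  Primrec.list_map hf (Primrec.to₂ (primrec_index.comp (Primrec.fst.comp
    (Primrec.snd.comp .snd))))

theorem primrec_stateLaw : Primrec₂ stateLaw := by
  have h : Primrec₂ fun (p : CounterMachine × ℕ) (x : ℕ × CounterOp × ℕ) => if x.1 = p.2 then
      and (bigAnd ((p.1.map fun y => y.2.1.index).map (opLaw x.2.1))) (nextState x.2.2)
      else neg top := by
    refine Primrec.ite ?_ (primrec_and (primrec_bigAnd ?_) ?_) (.const _)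
    · exact Primrec.eq.comp (Primrec.fst.comp .snd) (Primrec.snd.comp .fst)
    · exact Primrec.list_map (primrec_indices (Primrec.fst.comp .fst)) (Primrec.to₂
        (primrec_opLaw.comp (Primrec.fst.comp (Primrec.snd.comp (Primrec.snd.comp .fst))) .snd))
    · exact primrec_nextState.comp (Primrec.snd.comp (Primrec.snd.comp .snd))
  exact primrec_always (primrec_imp (primrec_letter 1 .snd)
    (primrec_bigOr (Primrec.list_map .fst h)))

theorem primrec_runFormula : Primrec runFormula := by
  have h : Primrec₂ fun (x : CounterMachine × ℕ × ℕ) (q : ℕ) =>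
      if q = x.2.2 then top else stateLaw x.1 q :=
    Primrec.ite (Primrec.eq.comp .snd (Primrec.snd.comp (Primrec.snd.comp .fst))) (.const _)
      (primrec_stateLaw.comp (Primrec.fst.comp .fst) .snd)
  exact primrec_and (primrec_letter 1 (Primrec.fst.comp .snd)) (primrec_and (primrec_bigAnd
    (Primrec.list_map (primrec_indices .fst) (Primrec.to₂ (primrec_counterLaw.comp .snd))))
    (primrec_bigAnd (Primrec.list_map (Primrec.list_cons.comp (Primrec.fst.comp .snd)
      (Primrec.list_map .fst (Primrec.to₂ (Primrec.snd.comp (Primrec.snd.comp .snd))))) h)))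

end

end RunFormula

/-! ### From a model of the formula to a run. -/

namespace RunFormula

open Formula

section

variable {F D : Frame.{u}} {v : ℕ → F.W → D.W → Prop}

theorem holds_growth {t : F.W} {d : D.W} {χ η : Formula} : Holds F D v t d (growth χ η) ↔
    (Holds F D v t d χ → ∀ s, F.R t s → Holds F D v s d χ) ∧
    (Holds F D v t d η → ¬ Holds F D v t d χ ∧ ∀ s, F.R t s → Holds F D v s d χ) ∧
    (¬ Holds F D v t d χ → (∃ s, F.R t s ∧ Holds F D v s d χ) →
      Holds F D v t d η ∨ ∃ s, F.R t s ∧ Holds F D v s d η) := by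
  simp only [growth, holds_and, holds_imp, holds_neg, holds_box0, holds_dia0, holds_or, and_imp]

/-- If `χ` is new at the next moment `t'`, then `η` holds at `t` or later. Later is impossible: `η`
excludes `χ` at the same moment, while `χ` persists from `t'` on. -/
theorem holds_next_iff {t t' : F.W} {d : D.W} {χ η : Formula} (ht : F.R t t')
    (hnext : ∀ s, F.R t s → s = t' ∨ F.R t' s)
    (h : ∀ s, t = s ∨ F.R t s → Holds F D v s d (growth χ η)) :
    Holds F D v t' d χ ↔ Holds F D v t d χ ∨ Holds F D v t d η := by
  obtain ⟨h1, h2, h3⟩ := holds_growth.1 (h t (.inl rfl))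
  constructor
  · intro hχ
    by_contra! hcon
    obtain hη | ⟨s, hs, hη⟩ := h3 hcon.1 ⟨t', ht, hχ⟩
    · exact hcon.2 hη
    · refine ((holds_growth.1 (h s (.inr hs))).2.1 hη).1 ?_
      rcases hnext s hs with rfl | hs'
      · exact hχ
      · exact (holds_growth.1 (h t' (.inr ht))).1 hχ s hs'
  · rintro (hχ | hη)
    exacts [h1 hχ t' ht, (h2 hη).2 t' ht]

theorem holds_counterLaw (hD : D ∈ diffFrames) {t : F.W} {d : D.W} {i : ℕ} :
    Holds F D v t d (counterLaw i) ↔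
      (∀ e, ¬ Holds F D v t e (added i) ∧ ¬ Holds F D v t e (removed i)) ∧
      ∀ s, t = s ∨ F.R t s → ∀ e,
        (Holds F D v s e (growth (added i) (adding i)) ∧
          Holds F D v s e (growth (removed i) (removing i))) ∧
        (Holds F D v s e (adding i) → ¬ Holds F D v s e (removed i)) ∧
        (Holds F D v s e (removing i) → Holds F D v s e (added i)) := by
  simp only [counterLaw, holds_and, holds_imp, holds_neg, holds_everywhere hD, holds_always hD]

/-- The token `e` ticks at some later moment; a moment strictly between would make that tick two
steps away, which the negated clause forbids. So this moment is the immediate successor of `t`. -/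
theorem holds_nextState (hD : D ∈ diffFrames) {t : F.W} {d : D.W} {q : ℕ} :
    Holds F D v t d (nextState q) ↔ ∃ e, (∃ s, F.R t s ∧ Holds F D v s e tick ∧
      Holds F D v s e (state q)) ∧
      ¬ ∃ s, F.R t s ∧ ∃ s', F.R s s' ∧ Holds F D v s' e tick := by
  simp only [nextState, holds_somewhere hD, holds_and, holds_neg, holds_dia0]

theorem holds_stateLaw (hD : D ∈ diffFrames) {t : F.W} {d : D.W} {M : CounterMachine} {q : ℕ} :
    Holds F D v t d (stateLaw M q) ↔ ∀ s, t = s ∨ F.R t s → ∀ e, Holds F D v s e (state q) →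
      ∃ x ∈ M, x.1 = q ∧ (∀ y ∈ M, Holds F D v s e (opLaw x.2.1 y.2.1.index)) ∧
        Holds F D v s e (nextState x.2.2) := by
  simp only [stateLaw, holds_always hD, holds_imp, holds_bigOr, List.mem_map]
  refine forall_congr' fun s => forall_congr' fun _ => forall_congr' fun e =>
    forall_congr' fun _ => ?_
  constructor
  · rintro ⟨_, ⟨x, hx, rfl⟩, h⟩
    split_ifs at h with hq
    · refine ⟨x, hx, hq, fun y hy => ?_, h.2⟩
      exact holds_bigAnd.1 h.1 _ (List.mem_map_of_mem (List.mem_map_of_mem hy))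
    · exact absurd holds_top h
  · rintro ⟨x, hx, hq, h, h'⟩
    refine ⟨_, ⟨x, hx, rfl⟩, ?_⟩
    rw [if_pos hq]
    refine ⟨holds_bigAnd.2 fun φ hφ => ?_, h'⟩
    obtain ⟨_, hj, rfl⟩ := List.mem_map.1 hφ
    obtain ⟨y, hy, rfl⟩ := List.mem_map.1 hj
    exact h y hy

theorem holds_runFormula {t : F.W} {d : D.W} {x : CounterMachine × ℕ × ℕ} :
    Holds F D v t d (runFormula x) ↔ Holds F D v t d (state x.2.1) ∧
      (∀ y ∈ x.1, Holds F D v t d (counterLaw y.2.1.index)) ∧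
      ∀ q, (q = x.2.1 ∨ ∃ y ∈ x.1, y.2.2 = q) → q ≠ x.2.2 → Holds F D v t d (stateLaw x.1 q) := by
  simp only [runFormula, holds_and, holds_bigAnd]
  refine and_congr_right fun _ => and_congr ?_ ?_
  · constructor
    · exact fun h y hy => h _ (List.mem_map_of_mem (List.mem_map_of_mem hy))
    · intro h φ hφ
      obtain ⟨_, hj, rfl⟩ := List.mem_map.1 hφ
      obtain ⟨y, hy, rfl⟩ := List.mem_map.1 hj
      exact h y hy
  · constructor
    · intro h q hq hne
      have := h _ (List.mem_map_of_mem (a := q) (by simpa [eq_comm] using hq))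
      rwa [if_neg hne] at this
    · intro h φ hφ
      obtain ⟨q, hq, rfl⟩ := List.mem_map.1 hφ
      split_ifs with hne
      · exact holds_top
      · exact h q (by simpa [eq_comm] using hq) hne

/-- The elements in counter `i` at time `t`. -/
def content (F D : Frame.{u}) (v : ℕ → F.W → D.W → Prop) (i : ℕ) (t : F.W) : Set D.W :=
  {d | Holds F D v t d (added i) ∧ ¬ Holds F D v t d (removed i)}

/-- The set `I` stands for the counters mentioned by the machine; contents are controlled only
there. An increment inserts one new token into the content, a decrement deletes one member, and all
other contents are unchanged. There may be infinitely many tokens, hence `encard`. -/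
theorem exists_effect (hD : D ∈ diffFrames) {t t' : F.W} {d : D.W} (ι : CounterOp) (c : ℕ → ℕ)
    {I : Set ℕ} (hι : ι.index ∈ I) (hop : ∀ i ∈ I, Holds F D v t d (opLaw ι i))
    (hadd : ∀ i ∈ I, ∀ e, Holds F D v t' e (added i) ↔
      Holds F D v t e (added i) ∨ Holds F D v t e (adding i))
    (hrem : ∀ i ∈ I, ∀ e, Holds F D v t' e (removed i) ↔
      Holds F D v t e (removed i) ∨ Holds F D v t e (removing i))
    (hadding : ∀ i ∈ I, ∀ e, Holds F D v t e (adding i) →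
      ¬ Holds F D v t e (added i) ∧ ¬ Holds F D v t e (removed i))
    (hremoving : ∀ i ∈ I, ∀ e, Holds F D v t e (removing i) →
      Holds F D v t e (added i) ∧ ¬ Holds F D v t e (removed i))
    (hc : ∀ i ∈ I, (content F D v i t).encard = c i) :
    ∃ c', ι.Effect c c' ∧ ∀ i ∈ I, (content F D v i t').encard = c' i := by
  have hop' : ∀ i ∈ I,
      (if ι = .inc i then ∃ e, ∀ e', Holds F D v t e' (adding i) ↔ e' = e
        else ∀ e, ¬ Holds F D v t e (adding i)) ∧
      (if ι = .dec i then ∃ e, ∀ e', Holds F D v t e' (removing i) ↔ e' = e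
        else ∀ e, ¬ Holds F D v t e (removing i)) ∧
      (ι = .test i → ∀ e, Holds F D v t e (added i) → Holds F D v t e (removed i)) := by
    intro i hi
    have h := hop i hi
    rw [opLaw, holds_and, holds_and] at h
    refine ⟨?_, ?_, fun ht => ?_⟩
    · split_ifs with hh
      · rw [if_pos hh, holds_unique hD] at h; exact h.1
      · rw [if_neg hh, holds_everywhere hD] at h; exact h.1
    · split_ifs with hh
      · rw [if_pos hh, holds_unique hD] at h; exact h.2.1
      · rw [if_neg hh, holds_everywhere hD (φ := (removing i).neg)] at h; exact h.2.1
    · have h := h.2.2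
      rw [if_pos ht, holds_everywhere hD] at h
      exact fun e => holds_imp.1 (h e)
  have hstay : ∀ i ∈ I, (∀ e, ¬ Holds F D v t e (adding i)) →
      (∀ e, ¬ Holds F D v t e (removing i)) → content F D v i t' = content F D v i t := by
    intro i hi h1 h2
    ext e
    simp only [content, Set.mem_ofPred_eq, hadd i hi, hrem i hi, h1 e, h2 e, or_false]
  match ι, hι, hop' with
  | .inc i, hι, hop' =>
    refine ⟨Function.update c i (c i + 1), ⟨by simp, fun j hj => by simp [hj]⟩, fun j hj => ?_⟩
    obtain ⟨h1, h2, -⟩ := hop' j hj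
    rw [if_neg (by simp)] at h2
    by_cases hji : j = i
    · subst hji
      rw [if_pos rfl] at h1
      obtain ⟨e, he⟩ := h1
      obtain ⟨ha, hb⟩ := hadding j hj e ((he e).2 rfl)
      have hins : content F D v j t' = insert e (content F D v j t) := by
        ext e'
        simp only [content, Set.mem_ofPred_eq, hadd j hj, hrem j hj, h2 e', or_false, he,
          Set.mem_insert_iff]
        constructor
        · tauto
        · rintro (rfl | h)
          exacts [⟨.inr rfl, hb⟩, ⟨.inl h.1, h.2⟩]
      rw [hins, Set.encard_insert_of_notMem fun h => ha h.1, hc j hj]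
      simp
    · rw [if_neg (by simpa using Ne.symm hji)] at h1
      rw [hstay j hj h1 h2, hc j hj]
      simp [hji]
  | .dec i, hι, hop' =>
    have hpos : 0 < c i ∧ (content F D v i t').encard = (c i - 1 : ℕ) := by
      obtain ⟨h1, h2, -⟩ := hop' i hι
      rw [if_neg (by simp)] at h1
      rw [if_pos rfl] at h2
      obtain ⟨e, he⟩ := h2
      have hmem := hremoving i hι e ((he e).2 rfl)
      have hdiff : content F D v i t' = content F D v i t \ {e} := by
        ext e'
        simp only [content, Set.mem_ofPred_eq, hadd i hι, hrem i hι, h1 e', or_false, he,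
          Set.mem_sdiff, Set.mem_singleton_iff]
        tauto
      have hcard := Set.encard_sdiff_singleton_add_one (s := content F D v i t) (a := e) hmem
      rw [← hdiff, hc i hι] at hcard
      -- The old cardinality is one more than the new one and equals the natural number `c i`; hence
      -- the new one is finite and `c i` is positive.
      have hfin : (content F D v i t').encard ≠ ⊤ := fun h => by
        rw [h] at hcard; exact absurd hcard (by simp)
      lift (content F D v i t').encard to ℕ using hfin with k
      norm_cast at hcard ⊢
      omega
    refine ⟨Function.update c i (c i - 1), ⟨hpos.1, by simp, fun j hj => by simp [hj]⟩,
      fun j hj => ?_⟩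
    by_cases hji : j = i
    · subst hji
      rw [hpos.2, Function.update_self]
    · obtain ⟨h1, h2, -⟩ := hop' j hj
      rw [if_neg (by simp)] at h1
      rw [if_neg (by simpa using Ne.symm hji)] at h2
      rw [hstay j hj h1 h2, hc j hj]
      simp [hji]
  | .test i, hι, hop' =>
    refine ⟨c, ⟨?_, fun _ => rfl⟩, fun j hj => ?_⟩
    · have hempty : content F D v i t = ∅ :=
        Set.eq_empty_of_forall_notMem fun e he => he.2 ((hop' i hι).2.2 rfl e he.1)
      have := hc i hι
      rw [hempty, Set.encard_empty] at this
      exact_mod_cast this.symm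
    · obtain ⟨h1, h2, -⟩ := hop' j hj
      rw [if_neg (by simp)] at h1 h2
      rw [hstay j hj h1 h2, hc j hj]

/-- Induction from later to earlier moments, which is well-founded because the order is finite. At a
moment whose state is not the goal, the laws supply an instruction, a next moment and the matching
contents there. -/
theorem cmReachability_of_holds (hF : F ∈ finLinFrames) (hD : D ∈ diffFrames) {t₀ : F.W} {d₀ : D.W}
    {x : CounterMachine × ℕ × ℕ} (h : Holds F D v t₀ d₀ (runFormula x)) : CMReachability x := by
  obtain ⟨M, q₀, qr⟩ := x
  obtain ⟨⟨hirr, htrans, htri⟩, hfin⟩ := hF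
  obtain ⟨hinit, hcounter, hstate⟩ := holds_runFormula.1 h
  dsimp only at hinit hcounter hstate
  let I : Set ℕ := {i | ∃ y ∈ M, y.2.1.index = i}
  have hwf : WellFounded fun s t => F.R t s := by
    have : IsTrans F.W fun s t => F.R t s := ⟨fun a b c h h' => htrans c b a h' h⟩
    have : Std.Irrefl fun s t => F.R t s := ⟨hirr⟩
    exact Finite.wellFounded_of_trans_of_irrefl _
  have hlater : ∀ {t s}, t₀ = t ∨ F.R t₀ t → t = s ∨ F.R t s → t₀ = s ∨ F.R t₀ s := by
    rintro t s (rfl | h) (rfl | h')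
    exacts [.inl rfl, .inr h', .inr h, .inr (htrans _ _ _ h h')]
  have main : ∀ t, t₀ = t ∨ F.R t₀ t → ∀ q c d, (q = q₀ ∨ ∃ y ∈ M, y.2.2 = q) →
      Holds F D v t d (state q) → (∀ i ∈ I, (content F D v i t).encard = c i) →
      ∃ c', Relation.ReflTransGen (CounterMachine.Step M) (q, c) (qr, c') := by
    intro t
    induction t using hwf.induction with
    | _ t ih =>
      intro ht q c d hq hd hc
      by_cases hqr : q = qr
      · subst hqr
        exact ⟨c, .refl⟩
      obtain ⟨y, hyM, rfl, hop, hnext⟩ :=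
        (holds_stateLaw hD).1 (hstate q hq hqr) t ht d hd
      obtain ⟨e, ⟨t', htt', htick, hstate'⟩, hno⟩ := (holds_nextState hD).1 hnext
      have hsucc : ∀ s, F.R t s → s = t' ∨ F.R t' s := by
        intro s hs
        rcases htri s t' with h | h | h
        · exact absurd ⟨s, hs, t', h, htick⟩ hno
        · exact .inl h
        · exact .inr h
      have hlaw : ∀ i ∈ I, ∀ s, t₀ = s ∨ F.R t₀ s → ∀ e,
          (Holds F D v s e (growth (added i) (adding i)) ∧
            Holds F D v s e (growth (removed i) (removing i))) ∧
          (Holds F D v s e (adding i) → ¬ Holds F D v s e (removed i)) ∧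
          (Holds F D v s e (removing i) → Holds F D v s e (added i)) := by
        rintro _ ⟨y, hy, rfl⟩
        exact ((holds_counterLaw hD).1 (hcounter y hy)).2
      obtain ⟨c', heff, hc'⟩ := exists_effect hD (t' := t') y.2.1 c (I := I) ⟨y, hyM, rfl⟩
        (by rintro _ ⟨z, hz, rfl⟩; exact hop z hz)
        (fun i hi e => holds_next_iff htt' hsucc fun s hs => (hlaw i hi s (hlater ht hs) e).1.1)
        (fun i hi e => holds_next_iff htt' hsucc fun s hs => (hlaw i hi s (hlater ht hs) e).1.2)
        (fun i hi e he => ⟨((holds_growth.1 (hlaw i hi t ht e).1.1).2.1 he).1,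
          (hlaw i hi t ht e).2.1 he⟩)
        (fun i hi e he => ⟨(hlaw i hi t ht e).2.2 he,
          ((holds_growth.1 (hlaw i hi t ht e).1.2).2.1 he).1⟩) hc
      obtain ⟨c'', hrun⟩ := ih t' htt' (hlater ht (.inr htt')) y.2.2 c' e (.inr ⟨y, hyM, rfl⟩)
        hstate' hc'
      exact ⟨c'', .head ⟨y.2.1, hyM, heff⟩ hrun⟩
  refine main t₀ (.inl rfl) q₀ _ d₀ (.inl rfl) hinit ?_
  rintro _ ⟨y, hy, rfl⟩
  rw [show content F D v y.2.1.index t₀ = ∅ from Set.eq_empty_of_forall_notMem fun e he =>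
    (((holds_counterLaw hD).1 (hcounter y hy)).1 e).1 he.1]
  simp

end

/-! A model for a given run -/

theorem exists_sequence_of_run {M : CounterMachine} {σ : Config} {qr : ℕ} {c : ℕ → ℕ}
    (h : Relation.ReflTransGen (CounterMachine.Step M) σ (qr, c)) :
    ∃ (n : ℕ) (ς : ℕ → Config) (ι : ℕ → CounterOp), ς 0 = σ ∧ (ς n).1 = qr ∧
      ∀ k < n, ((ς k).1, ι k, (ς (k + 1)).1) ∈ M ∧ (ι k).Effect (ς k).2 (ς (k + 1)).2 := by
  induction h using Relation.ReflTransGen.head_induction_on with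
  | refl => exact ⟨0, fun _ => (qr, c), fun _ => .test 0, rfl, rfl, fun k hk => by omega⟩
  | @head a b hs _ ih =>
    -- The values of `ς` and `ι` past the end of the run are arbitrary; this is why `runValuation`
    -- guards additions and removals by `t < n`.
    obtain ⟨n, ς, ι, rfl, hn, h⟩ := ih
    obtain ⟨ι₀, hι₀⟩ := hs
    refine ⟨n + 1, fun k => k.casesOn a ς, fun k => k.casesOn ι₀ ι, rfl, hn, ?_⟩
    rintro (_ | k) hk
    · exact hι₀
    · exact h k (by omega)

/-- The number of occurrences of the operation `κ` among the first `t` operations. -/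
def occurrences (ι : ℕ → CounterOp) (κ : CounterOp) (t : ℕ) : ℕ := Nat.count (fun k => ι k = κ) t

theorem occurrences_succ (ι : ℕ → CounterOp) (κ : CounterOp) (t : ℕ) :
    occurrences ι κ (t + 1) = occurrences ι κ t + if ι t = κ then 1 else 0 :=
  Nat.count_succ _ _

theorem occurrences_mono (ι : ℕ → CounterOp) (κ : CounterOp) : Monotone (occurrences ι κ) :=
  Nat.count_monotone _

/-- A counter holds the increments minus the decrements so far. In particular a queue never has more
removals than additions. -/
theorem counter_add_occurrences {n : ℕ} {ι : ℕ → CounterOp} {c : ℕ → ℕ → ℕ} (h0 : ∀ i, c 0 i = 0)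
    (h : ∀ k < n, (ι k).Effect (c k) (c (k + 1))) (i : ℕ) : ∀ t ≤ n,
      c t i + occurrences ι (.dec i) t = occurrences ι (.inc i) t := by
  intro t
  induction t with
  | zero => simp [occurrences, h0]
  | succ t ih =>
    intro ht
    have ih := ih (by omega)
    have he := h t (by omega)
    rw [occurrences_succ, occurrences_succ]
    match hκ : ι t with
    | .inc j =>
      rw [hκ] at he
      by_cases hji : i = j
      · subst hji
        simp only [if_true, reduceCtorEq, if_false, he.1]; omega
      · rw [he.2 i hji, if_neg (by simp), if_neg (by simpa using Ne.symm hji)]; omega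
    | .dec j =>
      rw [hκ] at he
      by_cases hji : i = j
      · subst hji
        have := he.1
        simp only [if_true, reduceCtorEq, if_false, he.2.1]; omega
      · rw [he.2.2 i hji, if_neg (by simpa using Ne.symm hji), if_neg (by simp)]; omega
    | .test j =>
      rw [hκ] at he
      rw [he.2 i, if_neg (by simp), if_neg (by simp)]; omega

/-- The valuation describing a run with states `q t` and operations `ι t`: counters are queues, and
the `k`-th element that is added to a counter is the number `k`. -/
def runValuation (n : ℕ) (q : ℕ → ℕ) (ι : ℕ → CounterOp) : ℕ → ℕ → ℕ → ℕ → Prop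
  | 0, _, t, d => d = t
  | 1, i, t, _ => i = q t
  | 2, i, t, d => d < occurrences ι (.inc i) t
  | 3, i, t, d => d < occurrences ι (.dec i) t
  | 4, i, t, d => t < n ∧ occurrences ι (.inc i) t ≤ d ∧ d < occurrences ι (.inc i) (t + 1)
  | _, i, t, d => t < n ∧ occurrences ι (.dec i) t ≤ d ∧ d < occurrences ι (.dec i) (t + 1)

/-- A discrete intermediate value argument; it finds the moment at which the token `d` is added or
removed. -/
theorem exists_le_lt_succ_of_lt {f : ℕ → ℕ} {d t s : ℕ} (hts : t ≤ s) (ht : f t ≤ d)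
    (hs : d < f s) : ∃ r, t ≤ r ∧ r < s ∧ f r ≤ d ∧ d < f (r + 1) := by
  induction s, hts using Nat.le_induction with
  | base => omega
  | succ s hts ih =>
    by_cases h : d < f s
    · obtain ⟨r, h1, h2, h3⟩ := ih h
      exact ⟨r, h1, by omega, h3⟩
    · exact ⟨s, hts, by omega, by omega, hs⟩

theorem satisfiable_of_cmReachability {x : CounterMachine × ℕ × ℕ} (hx : CMReachability x) :
    Satisfiable.{u} (classProd finLinFrames diffFrames) (runFormula x) := by
  obtain ⟨M, q₀, qr⟩ := x
  obtain ⟨c', hrun⟩ := hx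
  obtain ⟨n, ς, ι, h0, hn, hstep⟩ := exists_sequence_of_run hrun
  dsimp only at h0 hn hstep
  let F : Frame.{u} := ⟨ULift (Fin (n + 1)), ⟨⟨0⟩⟩, fun s t => s.down < t.down⟩
  let D : Frame.{u} := ⟨ULift ℕ, ⟨⟨0⟩⟩, fun s t => s ≠ t⟩
  have hF : F ∈ finLinFrames := by
    refine ⟨⟨fun x => lt_irrefl x.down, fun x y z => lt_trans (a := x.down), fun x y => ?_⟩,
      inferInstanceAs (Finite (ULift (Fin (n + 1))))⟩
    rcases lt_trichotomy x.down y.down with h | h | h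
    exacts [.inl h, .inr (.inl (ULift.ext _ _ h)), .inr (.inr h)]
  have hD : D ∈ diffFrames := fun _ _ => Iff.rfl
  let q : ℕ → ℕ := fun t => (ς t).1
  let v : ℕ → F.W → D.W → Prop := fun p t d =>
    runValuation n q ι p.unpair.1 p.unpair.2 t.down d.down
  have hv : ∀ k i (t : F.W) (d : D.W), Holds F D v t d (var (Nat.pair k i)) ↔
      runValuation n q ι k i t.down d.down := by
    intro k i t d
    rw [holds_var]
    simp only [v, Nat.unpair_pair]
  have hgrowth : ∀ (χ η : Formula) (f : ℕ → ℕ), Monotone f →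
      (∀ (t : F.W) (d : D.W), Holds F D v t d χ ↔ d.down < f t.down) →
      (∀ (t : F.W) (d : D.W), Holds F D v t d η ↔
        (t.down : ℕ) < n ∧ f t.down ≤ d.down ∧ d.down < f (t.down + 1)) →
      ∀ (t : F.W) (d : D.W), Holds F D v t d (growth χ η) := by
    intro χ η f hf hχ hη t d
    rw [holds_growth]
    simp only [hχ, hη]
    refine ⟨fun h s hs => h.trans_le (hf (le_of_lt hs)), fun h => ⟨by omega, fun s hs =>
      h.2.2.trans_le (hf hs)⟩, ?_⟩
    rintro h ⟨s, hs, h'⟩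
    have hs : (t.down : ℕ) < s.down := hs
    obtain ⟨r, hr, hrs, h1, h2⟩ := exists_le_lt_succ_of_lt hs.le (not_lt.1 h) h'
    have hsn := s.down.2
    rcases hr.eq_or_lt with rfl | hr
    · exact .inl ⟨by omega, h1, h2⟩
    · exact .inr ⟨⟨⟨r, by omega⟩⟩, hr, by dsimp only; omega, h1, h2⟩
  have hcount := counter_add_occurrences (n := n) (ι := ι) (c := fun t => (ς t).2)
    (fun i => by rw [h0]) fun k hk => (hstep k hk).2
  refine ⟨F.prod D, ⟨F, hF, D, hD, rfl⟩, fun p => {w | v p w.1 w.2}, (⟨0⟩, ⟨0⟩), ?_⟩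
  change Holds F D v ⟨0⟩ ⟨0⟩ (runFormula (M, q₀, qr))
  rw [holds_runFormula]
  refine ⟨(hv _ _ _ _).2 (by simp [runValuation, q, h0]), fun y _ => ?_, fun p _ hp => ?_⟩
  · rw [holds_counterLaw hD]
    generalize y.2.1.index = i
    refine ⟨fun e => ⟨?_, ?_⟩, fun s _ e => ⟨⟨?_, ?_⟩, ?_, ?_⟩⟩
    · rw [added, hv]; simp [runValuation, occurrences]
    · rw [removed, hv]; simp [runValuation, occurrences]
    · exact hgrowth _ _ _ (occurrences_mono ι (.inc i)) (hv 2 i) (hv 4 i) s e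
    · exact hgrowth _ _ _ (occurrences_mono ι (.dec i)) (hv 3 i) (hv 5 i) s e
    · rw [adding, removed, hv, hv]
      simp only [runValuation]
      have := hcount i s.down (by have := s.down.2; omega)
      omega
    · rw [removing, added, hv, hv]
      simp only [runValuation]
      rintro ⟨h1, h2, h3⟩
      have hs := hcount i s.down (by have := s.down.2; omega)
      have hs' := hcount i (s.down + 1) (by omega)
      rw [occurrences_succ] at h3 hs'
      -- A removal is a decrement of a positive counter, so by `hcount` there were fewer removals
      -- than additions before, and the token at the head of the queue has been added.
      split_ifs at h3 with hκ
      · have := (hstep _ h1).2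
        rw [hκ] at this
        have := this.1
        omega
      · omega
  · rw [holds_stateLaw hD]
    intro s _ e he
    rw [state, hv] at he
    simp only [runValuation] at he
    subst he
    -- The state at the last moment `n` is the goal, which has no law.
    have hs : (s.down : ℕ) < n := by
      have := s.down.2
      by_contra hcon
      exact hp ((congrArg q (show (s.down : ℕ) = n by omega)).trans hn)
    obtain ⟨hM, heff⟩ := hstep _ hs
    refine ⟨_, hM, rfl, fun y _ => ?_, ?_⟩
    · generalize y.2.1.index = j
      dsimp only
      rw [opLaw, holds_and, holds_and]
      refine ⟨?_, ?_, ?_⟩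
      · have hsucc := occurrences_succ ι (.inc j) s.down
        split_ifs with hκ
        · rw [if_pos hκ] at hsucc
          -- Tokens are numbered from `0` in the order of their addition, so the next one is the
          -- number of earlier additions.
          refine (holds_unique hD).2 ⟨⟨occurrences ι (.inc j) s.down⟩, fun e' => ?_⟩
          rw [adding, hv]
          simp only [runValuation]
          rw [ULift.ext_iff]
          dsimp only
          omega
        · rw [if_neg hκ] at hsucc
          refine (holds_everywhere hD).2 fun e' => ?_
          rw [holds_neg, adding, hv]
          simp only [runValuation]
          omega
      · have hsucc := occurrences_succ ι (.dec j) s.down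
        split_ifs with hκ
        · rw [if_pos hκ] at hsucc
          refine (holds_unique hD).2 ⟨⟨occurrences ι (.dec j) s.down⟩, fun e' => ?_⟩
          rw [removing, hv]
          simp only [runValuation]
          rw [ULift.ext_iff]
          dsimp only
          omega
        · rw [if_neg hκ] at hsucc
          refine (holds_everywhere hD).2 fun e' => ?_
          rw [holds_neg, removing, hv]
          simp only [runValuation]
          omega
      · split_ifs with hκ
        · refine (holds_everywhere hD).2 fun e' => ?_
          rw [holds_imp, added, removed, hv, hv]
          simp only [runValuation]
          rw [hκ] at heff
          have := heff.1
          have := hcount j s.down hs.le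
          omega
        · exact holds_top
    · rw [holds_nextState hD]
      -- The token `s + 1` ticks only at the moment `s + 1`, which is not two steps after `s`.
      refine ⟨⟨s.down + 1⟩, ⟨⟨⟨s.down + 1, by omega⟩⟩, ?_, ?_, ?_⟩, ?_⟩
      · change (s.down : ℕ) < s.down + 1
        omega
      · rw [tick, hv]; simp [runValuation]
      · rw [state, hv]; simp [runValuation, q]
      · rintro ⟨r, hr, r', hr', ht⟩
        rw [tick, hv] at ht
        simp only [runValuation] at ht
        have hr : (s.down : ℕ) < r.down := hr
        have hr' : (r.down : ℕ) < r'.down := hr'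
        omega

theorem cmReachability_iff_satisfiable (x : CounterMachine × ℕ × ℕ) :
    CMReachability x ↔
      Satisfiable.{u} (classProd finLinFrames diffFrames) (runFormula x) := by
  refine ⟨satisfiable_of_cmReachability, ?_⟩
  rintro ⟨_, ⟨F, hF, D, hD, rfl⟩, ν, ⟨t, d⟩, h⟩
  exact cmReachability_of_holds hF hD (v := fun p t d => (t, d) ∈ ν p) h

end RunFormula

end Bimodal

theorem theorem2 :
    REPred (Bimodal.Satisfiable.{u}
      (Bimodal.classProd Bimodal.finLinFrames Bimodal.diffFrames)) ∧
    ¬ ComputablePred (Bimodal.Satisfiable.{u}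
      (Bimodal.classProd Bimodal.finLinFrames Bimodal.diffFrames)) ∧
    ManyOneReducible Bimodal.CMReachability (Bimodal.Satisfiable.{u}
      (Bimodal.classProd Bimodal.finLinFrames Bimodal.diffFrames)) ∧
    ∀ φ : Bimodal.Formula,
      Bimodal.Satisfiable.{u}
        (Bimodal.classProd Bimodal.finLinFrames Bimodal.diffFrames) φ ↔
      Bimodal.Satisfiable.{u}
        (Bimodal.classProd Bimodal.finLinFrames Bimodal.finDiffFrames) φ := by
  have hred : ManyOneReducible Bimodal.CMReachability (Bimodal.Satisfiable.{u}
      (Bimodal.classProd Bimodal.finLinFrames Bimodal.diffFrames)) :=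
    ⟨Bimodal.RunFormula.runFormula, Bimodal.RunFormula.primrec_runFormula.to_comp,
      Bimodal.RunFormula.cmReachability_iff_satisfiable⟩
  exact ⟨Bimodal.rePred_satisfiable_finLin_diff,
    fun h => Bimodal.not_computablePred_cmReachability
      (ComputablePred.computable_of_manyOneReducible hred h),
    hred, Bimodal.satisfiable_finLin_diff_iff⟩
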